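/- Let $k\ge 4$ be an integer, let $\mathcal N=\mathcal N_0\mathcal N_1\mathcal N_2$ be a square-free positive integer (with $\mathcal N_i\ge 1$), and let $\chi$ be a Dirichlet character modulo $\mathcal N$, decomposed as $\chi=\chi_{\mathcal N_0}\chi_{\mathcal N_1}\chi_{\mathcal N_2}$ with $\chi_{\mathcal N_i}$ a character modulo $\mathcal N_i$; assume $\chi_{\mathcal N_1}^2=1$. Write elements of $Sp_2(\mathbb Z)$ (integral symplectic $4\times4$ matrices) in $2\times 2$ blocks as $\gamma=\begin{pmatrix}A_\gamma&B_\gamma\\C_\gamma&D_\gamma\end{pmatrix}$, and let $\Gamma_0(\mathcal N)=\{\gamma\in Sp_2(\mathbb Z): C_\gamma\equiv 0 \pmod{\mathcal N}\}$. Let $\mathfrak h$ be the set of $\tau=X+iY$ with $X,Y$ real symmetric $2\times2$ matrices and $Y$ positive definite. For $\rho=(\mathcal N_0,\mathcal N_1,\mathcal N_2)$ let $M_\rho$ be any integral diagonal $2\times 2$ matrix such that for each prime $p\mid\mathcal N$, modulo $p$, $M_\rho\equiv 0$ if $p\mid \mathcal N_0$, $M_\rho\equiv\mathrm{diag}(1,0)$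 if $p\mid\mathcal N_1$, and $M_\rho\equiv I$ if $p\mid\mathcal N_2$. Define $$\mathbb E_\rho(\tau)=\frac12\sum_{(M\ N)}\overline\chi(\det D_\gamma)\,\det(M\tau+N)^{-k}\qquad(\tau\in\mathfrak h),$$ where $(M\ N)=(M_\rho\ I)\gamma$ runs over representatives of the $SL_2(\mathbb Z)$-equivalence classes (for left multiplication) in the orbit $\{(M_\rho\ I)\gamma:\gamma\in\Gamma_0(\mathcal N)\}$. (The terms do not depend on the choice of representatives, because $\chi_{\mathcal N_1}^2=1$.) For a function $f$ on $\mathfrak h$ and a rational matrix $g=\begin{pmatrix}A&B\\C&D\end{pmatrix}$ put $(f|g)(\tau)=(\det g)^{k/2}\det(C\tau+D)^{-k}f\big((A\tau+B)(C\tau+D)^{-1}\big)$, and for a prime $p$ put $$f|T_1(p^2)=p^{k-3}\sum_\gamma\overline\chi(\det D_\gamma)\,f|\delta_1^{-1}\gamma,\qquad \delta_1=\mathrm{diag}(p,1,p^{-1},1),$$ where $\gamma$ varies over a set of representatives of the finitely many cosets $(\delta_1\Gamma_0(\mathcal N)\delta_1^{-1}\cap\Gamma_0(\mathcal N))\backslash\Gamma_0(\mathcal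 N)$. Then the series defining $\mathbb E_\rho(\tau)$ converges absolutely for every $\tau\in\mathfrak h$, and for every prime $q$ dividing $\mathcal N_2$, $$\mathbb E_\rho\,|\,T_1(q^2)=\chi_{\mathcal N_0}(q^2)\,(q+1)\,q^{2k-3}\,\mathbb E_\rho .$$ -/

import Mathlib

open scoped Matrix MatrixGroups

noncomputable section

namespace SiegelEis

/-- `2 × 2` matrices. -/
abbrev Mat2 (R : Type) := Matrix (Fin 2) (Fin 2) R

/-- `4 × 4` matrices, written in `2 × 2` blocks. -/
abbrev Mat4 (R : Type) := Matrix (Fin 2 ⊕ Fin 2) (Fin 2 ⊕ Fin 2) R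

/-- The group `Sp₂(ℤ)` of `4 × 4` integral symplectic matrices. -/
abbrev Sp2Z := Matrix.symplecticGroup (Fin 2) ℤ

/-- The lower left block `C` of `γ = (A B; C D)`. -/
abbrev blockC (γ : Sp2Z) : Mat2 ℤ := (γ : Mat4 ℤ).toBlocks₂₁

/-- The lower right block `D` of `γ = (A B; C D)`. -/
abbrev blockD (γ : Sp2Z) : Mat2 ℤ := (γ : Mat4 ℤ).toBlocks₂₂

/-- An element of `Sp₂(ℤ)` as a rational matrix. -/
abbrev toRat (γ : Sp2Z) : Mat4 ℚ := (γ : Mat4 ℤ).map (Int.cast : ℤ → ℚ)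

/-- `Γ₀(N)`: the `γ = (A B; C D)` in `Sp₂(ℤ)` with `C ≡ 0` modulo `N`. -/
def Gamma0 (N : ℕ) : Subgroup Sp2Z where
  carrier := {γ | ∀ i j, (N : ℤ) ∣ blockC γ i j}
  one_mem' := by
    intro i j
    simp [Matrix.toBlocks₂₁]
  mul_mem' := by
    intro a b ha hb i j
    have h : blockC (a * b) i j = ∑ l, blockC a i l * (b : Mat4 ℤ).toBlocks₁₁ l j
        + ∑ l, blockD a i l * blockC b l j := by
      simp [Matrix.toBlocks₂₁, Matrix.toBlocks₁₁, Matrix.toBlocks₂₂, Matrix.mul_apply]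
    rw [h]
    exact dvd_add (Finset.dvd_sum fun l _ => (ha i l).mul_right _)
      (Finset.dvd_sum fun l _ => (hb l j).mul_left _)
  inv_mem' := by
    intro a ha i j
    have h : blockC a⁻¹ i j = - blockC a j i := by
      simp [SymplecticGroup.coe_inv, Matrix.toBlocks₂₁, Matrix.J, Matrix.mul_apply,
        Matrix.one_apply]
    rw [h]
    exact (ha j i).neg_right

lemma toRat_mul {N : ℕ} (x y : Gamma0 N) : toRat (x * y : Gamma0 N) = toRat x * toRat y := by
  simpa [toRat] using Matrix.map_mul (L := ((x : Sp2Z) : Mat4 ℤ)) (M := ((y : Sp2Z) : Mat4 ℤ))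
    (f := Int.castRingHom ℚ)

/-- The Siegel upper half space of degree two: the `τ = X + iY` with `X`, `Y` real symmetric
and `Y` positive definite. -/
def siegelHalfSpace : Set (Mat2 ℂ) :=
  {τ | τᵀ = τ ∧ (τ.map Complex.im).PosDef}

/-- `(f | g)(τ) = (det g)^{k/2} det(Cτ + D)^{-k} f((Aτ + B)(Cτ + D)⁻¹)` for `g = (A B; C D)`. -/
def slash (k : ℕ) (f : Mat2 ℂ → ℂ) (g : Mat4 ℚ) (τ : Mat2 ℂ) : ℂ :=
  let c : ℚ → ℂ := fun x => (x : ℂ)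
  let A := g.toBlocks₁₁.map c
  let B := g.toBlocks₁₂.map c
  let C := g.toBlocks₂₁.map c
  let D := g.toBlocks₂₂.map c
  ((((g.det : ℚ) : ℝ) ^ ((k : ℝ) / 2) : ℝ) : ℂ) * ((C * τ + D).det ^ k)⁻¹ *
    f ((A * τ + B) * (C * τ + D)⁻¹)

/-! ### The Eisenstein series -/

/-- `M` is a diagonal integral matrix which, modulo each prime `q` dividing `N₀N₁N₂`, is
`0` if `q ∣ N₀`, `diag(1, 0)` if `q ∣ N₁`, and `I` if `q ∣ N₂`. -/
structure IsCuspMatrix (N₀ N₁ N₂ : ℕ) (M : Mat2 ℤ) : Prop where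
  isDiag : M.IsDiag
  mod_zero : ∀ q : ℕ, q.Prime → q ∣ N₀ → M 0 0 ≡ 0 [ZMOD q] ∧ M 1 1 ≡ 0 [ZMOD q]
  mod_one : ∀ q : ℕ, q.Prime → q ∣ N₁ → M 0 0 ≡ 1 [ZMOD q] ∧ M 1 1 ≡ 0 [ZMOD q]
  mod_two : ∀ q : ℕ, q.Prime → q ∣ N₂ → M 0 0 ≡ 1 [ZMOD q] ∧ M 1 1 ≡ 1 [ZMOD q]

/-- The matrix `(I 0; M I) γ`. -/
def cuspMul (M : Mat2 ℤ) (γ : Sp2Z) : Mat4 ℤ := Matrix.fromBlocks 1 0 M 1 * (γ : Mat4 ℤ)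

/-- For `γ, γ'` in `Γ₀(N)`: the coprime symmetric pairs `(M I)γ` and `(M I)γ'`, that is, the
bottom rows of `(I 0; M I)γ` and `(I 0; M I)γ'`, are `SL₂(ℤ)`-equivalent. -/
def pairSetoid (N : ℕ) (M : Mat2 ℤ) : Setoid (Gamma0 N) where
  r γ γ' := ∃ G : SL(2, ℤ),
    (cuspMul M γ').toBlocks₂₁ = (G : Mat2 ℤ) * (cuspMul M γ).toBlocks₂₁ ∧
    (cuspMul M γ').toBlocks₂₂ = (G : Mat2 ℤ) * (cuspMul M γ).toBlocks₂₂
  iseqv :=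
    { refl := fun γ => ⟨1, by simp⟩
      symm := by
        rintro γ γ' ⟨G, h1, h2⟩
        refine ⟨G⁻¹, ?_, ?_⟩
        · rw [h1, ← Matrix.mul_assoc, ← Matrix.SpecialLinearGroup.coe_mul]
          simp
        · rw [h2, ← Matrix.mul_assoc, ← Matrix.SpecialLinearGroup.coe_mul]
          simp
      trans := by
        rintro γ γ' γ'' ⟨G, h1, h2⟩ ⟨G', h1', h2'⟩
        refine ⟨G' * G, ?_, ?_⟩
        · rw [h1', h1, Matrix.SpecialLinearGroup.coe_mul, Matrix.mul_assoc]
        · rw [h2', h2, Matrix.SpecialLinearGroup.coe_mul, Matrix.mul_assoc] }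

/-- The `SL₂(ℤ)`-equivalence classes of pairs in the `Γ₀(N)`-orbit of `(M I)`. -/
abbrev PairClass (N : ℕ) (M : Mat2 ℤ) : Type := Quotient (pairSetoid N M)

/-- The term `χ̄(det D_γ) det(M'τ + N')^{-k}`, where `(M' N') = (M I)γ` is the bottom row of
`(I 0; M I)γ`. -/
def eisTerm (N k : ℕ) (χ : DirichletCharacter ℂ N) (M : Mat2 ℤ) (γ : Sp2Z) (τ : Mat2 ℂ) : ℂ :=
  (starRingEnd ℂ) (χ ((blockD γ).det : ZMod N)) *
    (((cuspMul M γ).toBlocks₂₁.map (Int.cast : ℤ → ℂ) * τ +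
      (cuspMul M γ).toBlocks₂₂.map (Int.cast : ℤ → ℂ)).det ^ k)⁻¹

/-- The Eisenstein series of weight `k`, level `N` and character `χ` of the cusp of
`(I 0; M I)`. Each `GL₂(ℤ)`-class of pairs in the orbit of `(M I)` consists of two
`SL₂(ℤ)`-classes, hence the factor `1/2`. (The sum over `GL₂(ℤ)`-classes is independent of
representatives only if `χ(-1) = (-1)^k`, and then it is equal to this one; otherwise this one
vanishes.) -/
def eisenstein (N k : ℕ) (χ : DirichletCharacter ℂ N) (M : Mat2 ℤ) (τ : Mat2 ℂ) : ℂ :=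
  (1 / 2 : ℂ) * ∑' c : PairClass N M, eisTerm N k χ M (c.out : Gamma0 N) τ

/-! ### The Hecke operator -/

/-- `δ₁ = diag(p, 1, p⁻¹, 1)`. -/
def delta1 (p : ℕ) : Mat4 ℚ :=
  Matrix.fromBlocks !![(p : ℚ), 0; 0, 1] 0 0 !![(p : ℚ)⁻¹, 0; 0, 1]

/-- `δΓ₀(N)δ⁻¹ ∩ Γ₀(N)` as a subgroup of `Γ₀(N)`, for an invertible matrix `δ`: the `g` with
`g δ = δ h` for some `h` in `Γ₀(N)`. -/
def conjInter (N : ℕ) (δ : Mat4 ℚ) : Subgroup (Gamma0 N) where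
  carrier := {g | ∃ h : Gamma0 N, toRat g * δ = δ * toRat h}
  one_mem' := ⟨1, by simp [toRat]⟩
  mul_mem' := by
    rintro a b ⟨h, hh⟩ ⟨h', hh'⟩
    refine ⟨h * h', ?_⟩
    rw [toRat_mul, toRat_mul, Matrix.mul_assoc, hh', ← Matrix.mul_assoc, hh, Matrix.mul_assoc]
  inv_mem' := by
    rintro a ⟨h, hh⟩
    refine ⟨h⁻¹, ?_⟩
    have e1 : toRat (1 : Gamma0 N) = 1 := by simp [toRat]
    have ha : toRat (a⁻¹ : Gamma0 N) * toRat a = 1 := by rw [← toRat_mul, inv_mul_cancel, e1]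
    have hb : toRat h * toRat (h⁻¹ : Gamma0 N) = 1 := by rw [← toRat_mul, mul_inv_cancel, e1]
    calc toRat (a⁻¹ : Gamma0 N) * δ
        = toRat (a⁻¹ : Gamma0 N) * (δ * toRat h) * toRat (h⁻¹ : Gamma0 N) := by
          rw [Matrix.mul_assoc, Matrix.mul_assoc, hb, Matrix.mul_one]
      _ = δ * toRat (h⁻¹ : Gamma0 N) := by
          rw [← hh, ← Matrix.mul_assoc, ha, Matrix.one_mul]

/-- The right cosets `(δ₁Γ₀(N)δ₁⁻¹ ∩ Γ₀(N)) \ Γ₀(N)`. -/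
abbrev HeckeCoset (N p : ℕ) : Type :=
  Quotient (QuotientGroup.rightRel (conjInter N (delta1 p)))

/-- There are only finitely many cosets: matrices in `Γ₀(N)` that agree modulo `Np²` lie in the
same coset. -/
lemma finite_heckeCoset (N p : ℕ) (hN : N ≠ 0) (hp : p ≠ 0) : Finite (HeckeCoset N p) := by
  have hn : NeZero (N * p ^ 2) := ⟨by positivity⟩
  have hpQ : (p : ℚ) ≠ 0 := by exact_mod_cast hp
  -- elements congruent to the identity modulo `Np²` lie in the subgroup
  have key : ∀ g : Gamma0 N, (∀ i j, ((N * p ^ 2 : ℕ) : ℤ) ∣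
      (((g : Sp2Z) : Mat4 ℤ) - 1) i j) → g ∈ conjInter N (delta1 p) := by
    intro g hg
    choose K hK using hg
    let e : Fin 2 ⊕ Fin 2 → ℕ := fun i =>
      if i = Sum.inl 0 then 0 else if i = Sum.inr 0 then 2 else 1
    let d : Fin 2 ⊕ Fin 2 → ℚ := Sum.elim ![(p : ℚ), 1] ![(p : ℚ)⁻¹, 1]
    have hd : delta1 p = Matrix.diagonal d := by
      ext i j
      rcases i with i | i <;> rcases j with j | j <;> fin_cases i <;> fin_cases j <;>
        simp [delta1, d, Matrix.diagonal]
    let w : Fin 2 ⊕ Fin 2 → Fin 2 ⊕ Fin 2 → ℤ := fun i j => (p : ℤ) ^ (2 + e i - e j)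
    have hw : ∀ i j, d i * (w i j : ℚ) = (p : ℚ) ^ 2 * d j := by
      intro i j
      rcases i with i | i <;> rcases j with j | j <;> fin_cases i <;> fin_cases j <;>
        simp [d, w, e] <;> field_simp
    let H : Mat4 ℤ := 1 + Matrix.of fun i j => (N : ℤ) * w i j * K i j
    have hgH : toRat g * delta1 p = delta1 p * H.map (Int.cast : ℤ → ℚ) := by
      rw [hd]
      ext i j
      rw [Matrix.mul_diagonal, Matrix.diagonal_mul]
      have h1 : ((g : Sp2Z) : Mat4 ℤ) i j = (1 : Mat4 ℤ) i j + (N * p ^ 2 : ℕ) * K i j := by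
        rw [← hK i j]; simp
      simp only [toRat, Matrix.map_apply, h1, H, Matrix.add_apply, Matrix.of_apply]
      have h2 := hw i j
      by_cases hij : i = j
      · subst hij
        push_cast
        simp only [Matrix.one_apply_eq]
        push_cast
        linear_combination (-(N : ℚ) * K i i) * h2
      · push_cast
        simp only [Matrix.one_apply_ne hij]
        push_cast
        linear_combination (-(N : ℚ) * K i j) * h2
    have hJ : delta1 p * Matrix.J (Fin 2) ℚ * (delta1 p)ᵀ = Matrix.J (Fin 2) ℚ := by
      simp [delta1, Matrix.J, Matrix.fromBlocks_multiply, Matrix.fromBlocks_transpose]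
      constructor <;> ext i j <;> fin_cases i <;> fin_cases j <;>
        simp [Matrix.vecMul, dotProduct, Fin.sum_univ_two, hpQ]
    have hgJ : toRat g * Matrix.J (Fin 2) ℚ * (toRat g)ᵀ = Matrix.J (Fin 2) ℚ := by
      have h := SymplecticGroup.mem_iff.1 (g : Sp2Z).2
      have h' := congrArg (fun X : Mat4 ℤ => X.map (Int.castRingHom ℚ)) h
      simp only [Matrix.map_mul, Matrix.map_J] at h'
      exact h'
    have hdet : IsUnit (delta1 p).det := by
      rw [hd, Matrix.det_diagonal]
      simp [d, Fin.prod_univ_two, hpQ]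
    have hHJQ : H.map (Int.cast : ℤ → ℚ) * Matrix.J (Fin 2) ℚ * (H.map (Int.cast : ℤ → ℚ))ᵀ
        = Matrix.J (Fin 2) ℚ := by
      have hH : H.map (Int.cast : ℤ → ℚ) = (delta1 p)⁻¹ * (toRat g * delta1 p) := by
        rw [hgH, ← Matrix.mul_assoc, Matrix.nonsing_inv_mul _ hdet, Matrix.one_mul]
      rw [hH]
      simp only [Matrix.transpose_mul]
      calc (delta1 p)⁻¹ * (toRat g * delta1 p) * Matrix.J (Fin 2) ℚ *
            ((delta1 p)ᵀ * (toRat g)ᵀ * ((delta1 p)⁻¹)ᵀ)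
          = (delta1 p)⁻¹ * (toRat g * (delta1 p * Matrix.J (Fin 2) ℚ * (delta1 p)ᵀ) *
            (toRat g)ᵀ) * ((delta1 p)⁻¹)ᵀ := by simp only [Matrix.mul_assoc]
        _ = (delta1 p)⁻¹ * (delta1 p * Matrix.J (Fin 2) ℚ * (delta1 p)ᵀ) *
            ((delta1 p)⁻¹)ᵀ := by rw [hJ, hgJ]
        _ = ((delta1 p)⁻¹ * delta1 p) * Matrix.J (Fin 2) ℚ *
            ((delta1 p)⁻¹ * delta1 p)ᵀ := by
              rw [Matrix.transpose_mul]; simp only [Matrix.mul_assoc]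
        _ = Matrix.J (Fin 2) ℚ := by
              rw [Matrix.nonsing_inv_mul _ hdet]; simp
    have hHJ : H ∈ Matrix.symplecticGroup (Fin 2) ℤ := by
      rw [SymplecticGroup.mem_iff]
      have hinj : Function.Injective
          (fun X : Mat4 ℤ => X.map (Int.castRingHom ℚ)) :=
        Matrix.map_injective (Int.castRingHom ℚ).injective_int
      apply hinj
      simp only [Matrix.map_mul, Matrix.map_J]
      exact hHJQ
    refine ⟨⟨⟨H, hHJ⟩, ?_⟩, hgH⟩
    intro i j
    simp only [blockC, Matrix.toBlocks₂₁, Matrix.of_apply, H, Matrix.add_apply]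
    rw [Matrix.one_apply_ne (by simp), zero_add, mul_assoc]
    exact dvd_mul_right _ _
  let F : HeckeCoset N p → Mat4 (ZMod (N * p ^ 2)) := fun c =>
    ((c.out : Gamma0 N) : Mat4 ℤ).map (Int.castRingHom (ZMod (N * p ^ 2)))
  refine Finite.of_injective F ?_
  intro c c' hcc
  rw [← Quotient.out_equiv_out]
  change QuotientGroup.rightRel _ _ _
  rw [QuotientGroup.rightRel_apply]
  apply key
  intro i j
  rw [← ZMod.intCast_zmod_eq_zero_iff_dvd]
  set a := c.out
  set b := c'.out
  have hab : ((b : Sp2Z) : Mat4 ℤ).map (Int.castRingHom (ZMod (N * p ^ 2))) =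
      ((a : Sp2Z) : Mat4 ℤ).map (Int.castRingHom (ZMod (N * p ^ 2))) := hcc.symm
  have h1 : (((b * a⁻¹ : Gamma0 N) : Sp2Z) : Mat4 ℤ).map
      (Int.castRingHom (ZMod (N * p ^ 2))) = 1 := by
    have h2 : (((b * a⁻¹ : Gamma0 N) : Sp2Z) : Mat4 ℤ) =
        ((b : Sp2Z) : Mat4 ℤ) * ((a⁻¹ : Gamma0 N) : Sp2Z) := rfl
    have h3 : ((a : Sp2Z) : Mat4 ℤ) * ((a⁻¹ : Gamma0 N) : Sp2Z) = 1 := by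
      have h4 : a * a⁻¹ = 1 := mul_inv_cancel a
      exact congrArg (fun x : Gamma0 N => ((x : Sp2Z) : Mat4 ℤ)) h4
    rw [h2, Matrix.map_mul, hab, ← Matrix.map_mul, h3]
    simp
  have h5 := congrFun (congrFun h1 i) j
  simp only [Matrix.map_apply] at h5
  rw [Matrix.sub_apply, Int.cast_sub]
  rw [show (((((b * a⁻¹ : Gamma0 N) : Sp2Z) : Mat4 ℤ) i j : ℤ) : ZMod (N * p ^ 2)) = _ from h5]
  by_cases hij : i = j
  · subst hij; simp
  · simp [Matrix.one_apply_ne hij]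

/-- The Hecke operator `T₁(p²)` in weight `k`, level `N`, character `χ`:
`f | T₁(p²) = p^{k-3} ∑_γ χ̄(det D_γ) f | δ₁⁻¹γ`, where `γ` varies over a set of
representatives of the (finitely many) cosets `(δ₁Γ₀(N)δ₁⁻¹ ∩ Γ₀(N)) \ Γ₀(N)`. -/
def heckeT1 (N k : ℕ) (χ : DirichletCharacter ℂ N) (p : ℕ) (f : Mat2 ℂ → ℂ) (τ : Mat2 ℂ) : ℂ :=
  (p : ℂ) ^ ((k : ℤ) - 3) * ∑ᶠ c : HeckeCoset N p,
    (starRingEnd ℂ) (χ ((blockD (c.out : Gamma0 N)).det : ZMod N)) *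
      slash k f ((delta1 p)⁻¹ * toRat (c.out : Gamma0 N)) τ

end SiegelEis

end

noncomputable section

/-! ### Vectors on the null cone of a quadratic form of signature `(3, 2)` -/

namespace SiegelEis

/-! Convergence. The 2 × 2 minors of a coprime symmetric pair `(C D)` are Plücker coordinates: they
determine its `SL₂(ℤ)`-class (`eq_mul_of_minor_eq`), and symmetry cuts the six of them down to an
integral null vector of a quadratic form in five variables. Each minor is at most a constant
depending on `τ` times `|det(Cτ + D)|` (`exists_minor_le`). For `k ≥ 4` the Eisenstein series is
therefore dominated by the sum of `(1 + ‖p‖)⁻⁴` over the null cone, which converges by counting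
conic solutions modulo `p₀` (`summable_nullCone`).

Eigenvalue. Let `Γ = Γ₀(N)`, let `H` be the stabilizer of the class of `(M I)`, and let `K = δ₁Γδ₁⁻¹
∩ Γ`. The series is a sum over `H \ Γ`, and applying `T₁(q²)` makes it a sum over pairs of cosets
`(Hγ₁, Kγ₂)`. Two facts special to `q ∣ N₂` (where `M ≡ I` modulo `q`) make it collapse. First,
every `γ₁` can be moved inside `Hγ₁` to some `l'` with `lδ₁ = δ₁l'`, `l ∈ Γ`
(`exists_mem_cuspStab_mul_deltaConj`). Second, some `g ∈ Γ` satisfies `(M I)gδ₁ = diag(q, 1)(M I)`.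
Together they give `diag(q, 1)(M I)l'δ₁⁻¹γ₂ = (M I)glγ₂`, so every term of the double sum is a term
of the original series times `q^k χ(det D_g) = q^k χ₀(q²)`.

Each class in `H \ Γ` arises `q + 1` times, because `H ∩ gKg⁻¹` is the preimage in `H` of a Borel
subgroup of `SL₂(𝔽_q)` and its cosets form the projective line (`conj_mem_conjInter_iff`,
`exists_rep_cuspStab`). The rearrangement is the group-theoretic `finsum_tsum_rightCosets`; with the
factor `q^{k-3}` of the operator it gives the eigenvalue. -/

lemma card_dvd_mul_sub_le_gcd (m b : ℕ) (hm : 0 < m) (c : ℤ) :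
    ((Finset.range m).filter fun x : ℕ => (m : ℤ) ∣ b * x - c).card ≤ m.gcd b := by
  have hg : 0 < m.gcd b := Nat.gcd_pos_of_pos_left _ hm
  obtain ⟨m', hm'⟩ := Nat.gcd_dvd_left m b
  obtain ⟨b', hb'⟩ := Nat.gcd_dvd_right m b
  have hcop : Nat.Coprime m' b' := by
    have := Nat.coprime_div_gcd_div_gcd hg
    rwa [Nat.div_eq_of_eq_mul_right hg hm', Nat.div_eq_of_eq_mul_right hg hb'] at this
  set g := m.gcd b
  have hm'0 : 0 < m' := Nat.pos_of_ne_zero (by rintro rfl; simp at hm'; omega)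
  rw [← Finset.card_range g]
  -- Two solutions are congruent modulo `m' = m / g`, so a solution is determined by its quotient by
  -- `m'`, which is less than `g`.
  refine Finset.card_le_card_of_injOn (fun x => x / m') ?_ ?_
  · intro x hx
    have hx : x < m := by simpa using (Finset.mem_filter.1 (Finset.mem_coe.1 hx)).1
    simp only [Finset.coe_range, Set.mem_Iio]
    rw [Nat.div_lt_iff_lt_mul hm'0, ← hm']
    exact hx
  · intro x hx y hy hxy
    have hx := (Finset.mem_filter.1 (Finset.mem_coe.1 hx)).2
    have hy := (Finset.mem_filter.1 (Finset.mem_coe.1 hy)).2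
    have h1 : (m : ℤ) ∣ b * (x - y) := by
      have := dvd_sub hx hy
      rwa [show (b : ℤ) * x - c - (b * y - c) = b * (x - y) by ring] at this
    have h2 : (m' : ℤ) ∣ b' * (x - y) := by
      rw [hm', hb'] at h1
      push_cast at h1
      rw [mul_assoc] at h1
      exact Int.dvd_of_mul_dvd_mul_left (by exact_mod_cast hg.ne') h1
    have h3 : (m' : ℤ) ∣ x - y :=
      IsCoprime.dvd_of_dvd_mul_left (Nat.isCoprime_iff_coprime.2 hcop) h2
    have h4 : x % m' = y % m' := by
      have h5 : (x : ℤ) % m' = y % m' := (Int.modEq_iff_dvd.2 h3).symm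
      exact_mod_cast h5
    have hxy : x / m' = y / m' := hxy
    exact (Nat.div_add_mod x m').symm.trans (hxy ▸ h4 ▸ Nat.div_add_mod y m')

/-- Grouping by the value `g` of the gcd, each divisor contributes `φ(m / g) g ≤ m`. -/
lemma sum_gcd_le (m : ℕ) : ∑ t ∈ Finset.range m, m.gcd t ≤ m * m.divisors.card := by
  rcases Nat.eq_zero_or_pos m with rfl | hm
  · simp
  rw [← Finset.sum_fiberwise_of_maps_to (s := Finset.range m) (t := m.divisors)
    (g := fun t => m.gcd t)
    (fun t _ => Nat.mem_divisors.2 ⟨Nat.gcd_dvd_left m t, hm.ne'⟩)]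
  rw [mul_comm, ← smul_eq_mul]
  refine Finset.sum_le_card_nsmul _ _ _ fun g hg => ?_
  have hgm := (Nat.mem_divisors.1 hg).1
  have h1 : ∑ t ∈ (Finset.range m).filter (fun t => m.gcd t = g), m.gcd t =
      (m / g).totient * g := by
    rw [Nat.totient_div_of_dvd hgm, ← smul_eq_mul, ← Finset.sum_const]
    exact Finset.sum_congr rfl fun t ht => (Finset.mem_filter.1 ht).2
  rw [h1]
  calc (m / g).totient * g ≤ m / g * g := Nat.mul_le_mul_right _ (Nat.totient_le _)
    _ = m := Nat.div_mul_cancel hgm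

lemma card_divisors_le_two_mul_sqrt (m : ℕ) : m.divisors.card ≤ 2 * m.sqrt := by
  have h1 : m.divisors ⊆ (Finset.Icc 1 m.sqrt) ∪ (Finset.Icc 1 m.sqrt).image (fun d => m / d) := by
    intro d hd
    obtain ⟨hdm, hm⟩ := Nat.mem_divisors.1 hd
    obtain ⟨e, rfl⟩ := hdm
    have hd0 : 0 < d := Nat.pos_of_ne_zero (by rintro rfl; simp at hm)
    have he0 : 0 < e := Nat.pos_of_ne_zero (by rintro rfl; simp at hm)
    rw [Finset.mem_union]
    rcases le_total d e with h | h
    · left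
      rw [Finset.mem_Icc]
      exact ⟨hd0, Nat.le_sqrt.2 (Nat.mul_le_mul_left _ h)⟩
    · right
      rw [Finset.mem_image]
      exact ⟨e, Finset.mem_Icc.2 ⟨he0, Nat.le_sqrt.2 (Nat.mul_le_mul_right _ h)⟩,
        Nat.mul_div_cancel _ he0⟩
  calc m.divisors.card ≤ _ := Finset.card_le_card h1
    _ ≤ _ := Finset.card_union_le _ _
    _ ≤ m.sqrt + m.sqrt := by
      gcongr
      · simp
      · exact Finset.card_image_le.trans (by simp)
    _ = _ := by ring

/-- The solutions of `b₁ b₃ ≡ b₂²` modulo `m`. -/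
def conicSolutions (m : ℕ) : Finset (ℕ × ℕ × ℕ) :=
  (Finset.range m ×ˢ Finset.range m ×ˢ Finset.range m).filter
    fun b => (m : ℤ) ∣ b.1 * b.2.2 - (b.2.1 : ℤ) ^ 2

/-- For fixed `b₁`, `b₂` the congruence is linear in `b₃`, with at most `gcd(m, b₁)` solutions; the
divisor bound then saves a factor of order `√m` over the trivial `m³`, which is what convergence
needs. -/
lemma card_conicSolutions_le (m : ℕ) : (conicSolutions m).card ≤ m ^ 2 * (2 * m.sqrt) := by
  rcases Nat.eq_zero_or_pos m with rfl | hm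
  · simp [conicSolutions]
  have h1 : (conicSolutions m).card = ∑ b₁ ∈ Finset.range m, ∑ b₂ ∈ Finset.range m,
      ((Finset.range m).filter fun x : ℕ => (m : ℤ) ∣ b₁ * x - (b₂ : ℤ) ^ 2).card := by
    simp only [conicSolutions, Finset.card_filter, Finset.sum_product]
  rw [h1]
  calc _ ≤ ∑ b₁ ∈ Finset.range m, ∑ b₂ ∈ Finset.range m, m.gcd b₁ :=
        Finset.sum_le_sum fun b₁ _ => Finset.sum_le_sum fun b₂ _ =>
          card_dvd_mul_sub_le_gcd m b₁ hm _
    _ = m * ∑ b₁ ∈ Finset.range m, m.gcd b₁ := by simp [Finset.mul_sum]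
    _ ≤ m * (m * (2 * m.sqrt)) := by
        gcongr
        exact (sum_gcd_le m).trans (Nat.mul_le_mul_left _ (card_divisors_le_two_mul_sqrt m))
    _ = _ := by ring

lemma summable_conicSolutions :
    Summable fun x : Σ m : ℕ, conicSolutions m => ((x.1 : ℝ) ^ 4)⁻¹ := by
  rw [summable_sigma_of_nonneg fun _ => by positivity]
  refine ⟨fun m => Summable.of_finite, ?_⟩
  have h2 : Summable fun m : ℕ => 2 * ((m : ℝ) ^ (3 / 2 : ℝ))⁻¹ :=
    (Real.summable_nat_rpow_inv.2 (by norm_num)).mul_left 2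
  refine Summable.of_nonneg_of_le (fun m => tsum_nonneg fun _ => by positivity) (fun m => ?_) h2
  dsimp only
  rw [tsum_fintype, Finset.sum_const, nsmul_eq_mul]
  rcases Nat.eq_zero_or_pos m with rfl | hm
  · simp [conicSolutions]
  have hm' : (0 : ℝ) < m := by exact_mod_cast hm
  have h3 : ((Finset.univ : Finset (conicSolutions m)).card : ℝ) ≤
      (m : ℝ) ^ 2 * (2 * (m : ℝ) ^ (1 / 2 : ℝ)) := by
    rw [Finset.card_univ, Fintype.card_coe, ← Real.sqrt_eq_rpow]
    calc ((conicSolutions m).card : ℝ) ≤ ((m ^ 2 * (2 * m.sqrt) : ℕ) : ℝ) := by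
          exact_mod_cast card_conicSolutions_le m
      _ ≤ _ := by
          push_cast
          gcongr
          exact Real.nat_sqrt_le_real_sqrt
  calc _ ≤ (m : ℝ) ^ 2 * (2 * (m : ℝ) ^ (1 / 2 : ℝ)) * ((m : ℝ) ^ 4)⁻¹ := by gcongr
    _ = 2 * ((m : ℝ) ^ (3 / 2 : ℝ))⁻¹ := by
      rw [← Real.rpow_natCast, ← Real.rpow_natCast, ← Real.rpow_neg hm'.le,
        ← Real.rpow_neg hm'.le, mul_left_comm, mul_assoc, ← Real.rpow_add hm',
        ← Real.rpow_add hm']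
      norm_num

/-! ### Convergence of the sum over the null cone -/

/-- A weight on `ℤ` that is summable, and whose cube is `(1 + |x|)⁻⁴`. -/
def intWeight (x : ℤ) : ℝ := (1 + |(x : ℝ)|) ^ (-(4 / 3) : ℝ)

lemma intWeight_nonneg (x : ℤ) : 0 ≤ intWeight x := by unfold intWeight; positivity

lemma summable_intWeight : Summable intWeight := by
  have h := Real.summable_abs_int_rpow (b := 4 / 3) (by norm_num)
  refine Summable.of_norm_bounded_eventually h ?_
  -- The comparison fails at `x = 0`, where the real power `0 ^ (-4/3)` is `0` by convention.
  filter_upwards [(Set.finite_singleton (0 : ℤ)).compl_mem_cofinite] with x hx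
  have hx : x ≠ 0 := by simpa using hx
  rw [Real.norm_of_nonneg (intWeight_nonneg x)]
  exact Real.rpow_le_rpow_of_nonpos (by positivity) (by linarith) (by norm_num)

/-- The exponent 4 is shared equally among three integer variables, leaving `4/3 > 1` for each. -/
lemma inv_pow_four_le_intWeight {B : ℝ} {x y z : ℤ} (hx : 1 + |(x : ℝ)| ≤ B)
    (hy : 1 + |(y : ℝ)| ≤ B) (hz : 1 + |(z : ℝ)| ≤ B) :
    (B ^ 4)⁻¹ ≤ intWeight x * intWeight y * intWeight z := by
  have hB : 0 < B := by linarith [abs_nonneg (x : ℝ)]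
  have key : ∀ w : ℤ, 1 + |(w : ℝ)| ≤ B → B ^ (-(4 / 3) : ℝ) ≤ intWeight w := fun w hw =>
    Real.rpow_le_rpow_of_nonpos (by positivity) hw (by norm_num)
  have h : (B ^ 4)⁻¹ = B ^ (-(4 / 3) : ℝ) * B ^ (-(4 / 3) : ℝ) * B ^ (-(4 / 3) : ℝ) := by
    rw [← Real.rpow_add hB, ← Real.rpow_add hB, ← Real.rpow_natCast, ← Real.rpow_neg hB.le]
    norm_num
  rw [h]
  have := intWeight_nonneg
  gcongr
  exacts [mul_nonneg (this _) (this _), this _, key x hx, key y hy, key z hz]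

lemma summable_intWeight_three :
    Summable fun a : ℤ × ℤ × ℤ => intWeight a.1 * intWeight a.2.1 * intWeight a.2.2 := by
  have h1 := summable_intWeight.mul_of_nonneg summable_intWeight intWeight_nonneg intWeight_nonneg
  have h2 := summable_intWeight.mul_of_nonneg h1 intWeight_nonneg
    (fun x => mul_nonneg (intWeight_nonneg _) (intWeight_nonneg _))
  simpa only [mul_assoc] using h2

/-- The integral null vectors of `p₀p₄ = p₁p₃ - p₂²`. -/
def nullCone : Set (Fin 5 → ℤ) := {p | p 0 * p 4 = p 1 * p 3 - p 2 ^ 2}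

lemma abs_coord_le_norm (p : Fin 5 → ℤ) (i : Fin 5) : |(p i : ℝ)| ≤ ‖p‖ := by
  simpa [Int.norm_eq_abs] using norm_le_pi_norm p i

/-- Dividing `p₁, p₂, p₃` by `p₀` with remainder gives remainders solving the conic congruence
modulo `m = |p₀|` and three quotients of size at most about `‖p‖ / m`. So `(1 + ‖p‖)⁻⁴` is bounded
by `m⁻⁴` times a product of weights in the quotients, and the two sums separate. -/
lemma summable_nullCone_of_ne : Summable fun p : {p : nullCone | p.1 0 ≠ 0} =>
    ((1 + ‖p.1.1‖) ^ 4)⁻¹ := by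
  have hw := summable_intWeight_three
  have hb : Summable fun s : Bool => (1 : ℝ) := Summable.of_finite
  have hs := (hb.mul_of_nonneg summable_conicSolutions (fun _ => zero_le_one)
    (fun _ => by positivity)).mul_of_nonneg hw (fun _ => by positivity)
    (fun a => mul_nonneg (mul_nonneg (intWeight_nonneg _) (intWeight_nonneg _))
      (intWeight_nonneg _))
  have hsol : ∀ p : {p : nullCone | p.1 0 ≠ 0},
      ((p.1.1 1 % p.1.1 0).toNat, (p.1.1 2 % p.1.1 0).toNat, (p.1.1 3 % p.1.1 0).toNat) ∈
        conicSolutions (p.1.1 0).natAbs := by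
    rintro ⟨⟨p, hp⟩, hp0⟩
    have hp0 : p 0 ≠ 0 := hp0
    have hp : p 0 * p 4 = p 1 * p 3 - p 2 ^ 2 := hp
    have hr : ∀ x : ℤ, ((x % p 0).toNat : ℤ) = x % p 0 := fun x =>
      Int.toNat_of_nonneg (Int.emod_nonneg _ hp0)
    have hlt : ∀ x : ℤ, (x % p 0).toNat < (p 0).natAbs := fun x => by
      have h1 := Int.emod_lt_abs x hp0
      have h2 := hr x
      rw [Int.abs_eq_natAbs] at h1
      omega
    simp only [conicSolutions, Finset.mem_filter, Finset.mem_product, Finset.mem_range]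
    refine ⟨⟨hlt _, hlt _, hlt _⟩, ?_⟩
    rw [Int.natAbs_dvd]
    simp only [hr]
    have hd : ∀ x : ℤ, x % p 0 = x - p 0 * (x / p 0) := fun x => Int.emod_def x (p 0)
    rw [hd, hd, hd]
    refine ⟨p 4 - p 1 * (p 3 / p 0) - p 3 * (p 1 / p 0) + p 0 * (p 1 / p 0) * (p 3 / p 0)
      + 2 * p 2 * (p 2 / p 0) - p 0 * (p 2 / p 0) ^ 2, ?_⟩
    linear_combination -hp
  -- The Boolean records the sign of `p₀`; `p₄` needs no slot, since the cone equation determines it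
  -- when `p₀ ≠ 0`.
  let ι : {p : nullCone | p.1 0 ≠ 0} → (Bool × Σ m : ℕ, conicSolutions m) × (ℤ × ℤ × ℤ) :=
    fun p => ((decide (0 < p.1.1 0), ⟨(p.1.1 0).natAbs, ⟨_, hsol p⟩⟩),
      (p.1.1 1 / p.1.1 0, p.1.1 2 / p.1.1 0, p.1.1 3 / p.1.1 0))
  have hι : Function.Injective ι := by
    rintro ⟨⟨p, hp⟩, hp0⟩ ⟨⟨p', hp'⟩, hp0'⟩ h
    have hp0 : p 0 ≠ 0 := hp0
    have hp0' : p' 0 ≠ 0 := hp0'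
    have hp : p 0 * p 4 = p 1 * p 3 - p 2 ^ 2 := hp
    have hp' : p' 0 * p' 4 = p' 1 * p' 3 - p' 2 ^ 2 := hp'
    simp only [ι, Prod.mk.injEq, decide_eq_decide] at h
    obtain ⟨⟨h1, h2⟩, h3, h4, h5⟩ := h
    have h6 := congrArg (fun x : Σ m : ℕ, conicSolutions m => (x.1, x.2.1)) h2
    simp only [Prod.mk.injEq] at h6
    obtain ⟨h6, h7, h8, h9⟩ := h6
    have h0 : p 0 = p' 0 := by omega
    rw [← h0] at h3 h4 h5 h7 h8 h9
    have key : ∀ x y : ℤ, (x % p 0).toNat = (y % p 0).toNat → x / p 0 = y / p 0 → x = y := by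
      intro x y hxy hxy'
      have := Int.emod_nonneg x hp0
      have := Int.emod_nonneg y hp0
      rw [← Int.emod_add_mul_ediv x (p 0), ← Int.emod_add_mul_ediv y (p 0), hxy']
      omega
    have e1 := key _ _ h7 h3
    have e2 := key _ _ h8 h4
    have e3 := key _ _ h9 h5
    have e4 : p 4 = p' 4 := by
      apply mul_left_cancel₀ hp0
      rw [hp, h0, hp', e1, e2, e3]
    apply Subtype.ext
    apply Subtype.ext
    funext i
    fin_cases i <;> assumption
  -- The constant 81 is `3 ^ 4`, from the bound `3 (1 + ‖p‖) / m` on the quotients below.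
  refine Summable.of_nonneg_of_le (fun _ => by positivity) ?_
    ((hs.comp_injective hι).mul_left 81)
  rintro ⟨⟨p, hp⟩, hp0⟩
  have hp0 : p 0 ≠ 0 := hp0
  set m : ℝ := |(p 0 : ℝ)|
  have hm : 0 < m := abs_pos.2 (by exact_mod_cast hp0)
  have hB : ∀ i, |(p i : ℝ)| ≤ ‖p‖ := abs_coord_le_norm p
  have hq : ∀ i, 1 + |((p i / p 0 : ℤ) : ℝ)| ≤ 3 * (1 + ‖p‖) / m := by
    intro i
    rw [le_div_iff₀ hm]
    have h1 : |((p i / p 0 : ℤ) : ℝ)| * m ≤ |(p i : ℝ)| + m := by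
      rw [← abs_mul]
      have h2 : ((p i / p 0 : ℤ) : ℝ) * (p 0 : ℝ) = p i - ((p i % p 0 : ℤ) : ℝ) := by
        have := Int.emod_add_mul_ediv (p i) (p 0)
        have : ((p i % p 0 : ℤ) : ℝ) + (p 0 : ℝ) * ((p i / p 0 : ℤ) : ℝ) = p i := by
          exact_mod_cast this
        linarith
      rw [h2]
      refine (abs_sub _ _).trans ?_
      gcongr
      rw [abs_of_nonneg (by exact_mod_cast Int.emod_nonneg _ hp0)]
      have := (Int.emod_lt_abs (p i) hp0).le
      have : ((p i % p 0 : ℤ) : ℝ) ≤ ((|p 0| : ℤ) : ℝ) := by exact_mod_cast this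
      simpa [m] using this
    have h3 := hB i
    have h4 : m ≤ ‖p‖ := hB 0
    nlinarith
  have h := inv_pow_four_le_intWeight (hq 1) (hq 2) (hq 3)
  have hcast : (((p 0).natAbs : ℕ) : ℝ) = m := by
    simp [m, Nat.cast_natAbs]
  simp only [Function.comp_apply, ι, hcast]
  have e : ((1 + ‖p‖) ^ 4)⁻¹ = 81 * (1 * (m ^ 4)⁻¹ * ((3 * (1 + ‖p‖) / m) ^ 4)⁻¹) := by
    have : (1 + ‖p‖) ≠ 0 := by positivity
    field_simp
    norm_num
  rw [e]
  gcongr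

lemma summable_nullCone : Summable fun p : nullCone => ((1 + ‖p.1‖) ^ 4)⁻¹ := by
  have hw := summable_intWeight_three
  refine Summable.add_compl (s := {p : nullCone | p.1 0 ≠ 0}) summable_nullCone_of_ne ?_
  -- With `p₀ = 0` the equation is `p₁p₃ = p₂²`: if `p₁ = 0` then `p₂ = 0` and `p₃, p₄` are free;
  -- otherwise `p₁, p₂` determine `p₃`. Three parameters suffice either way.
  let ι : ({p : nullCone | p.1 0 ≠ 0}ᶜ : Set nullCone) → Bool × (ℤ × ℤ × ℤ) := fun p =>
    if p.1.1 1 = 0 then (false, (p.1.1 3, p.1.1 4, 0)) else (true, (p.1.1 1, p.1.1 2, p.1.1 4))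
  have hι : Function.Injective ι := by
    rintro ⟨⟨p, hp⟩, hp0⟩ ⟨⟨p', hp'⟩, hp0'⟩ h
    have hp0 : p 0 = 0 := by simpa using hp0
    have hp0' : p' 0 = 0 := by simpa using hp0'
    have hp : p 0 * p 4 = p 1 * p 3 - p 2 ^ 2 := hp
    have hp' : p' 0 * p' 4 = p' 1 * p' 3 - p' 2 ^ 2 := hp'
    rw [hp0, zero_mul] at hp
    rw [hp0', zero_mul] at hp'
    simp only [ι] at h
    have : p 1 = p' 1 ∧ p 2 = p' 2 ∧ p 3 = p' 3 ∧ p 4 = p' 4 := by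
      split_ifs at h with h1 h2 h2
      · simp only [Prod.mk.injEq] at h
        rw [h1, zero_mul] at hp
        rw [h2, zero_mul] at hp'
        have e1 : p 2 = 0 := pow_eq_zero_iff two_ne_zero |>.1 (by linarith)
        have e2 : p' 2 = 0 := pow_eq_zero_iff two_ne_zero |>.1 (by linarith)
        exact ⟨h1.trans h2.symm, e1.trans e2.symm, h.2.1, h.2.2.1⟩
      · simp at h
      · simp at h
      · simp only [Prod.mk.injEq] at h
        obtain ⟨-, e1, e2, e4⟩ := h
        refine ⟨e1, e2, mul_left_cancel₀ h1 ?_, e4⟩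
        rw [e1, e2] at hp
        rw [e1]
        linarith
    obtain ⟨e1, e2, e3, e4⟩ := this
    have e0 : p 0 = p' 0 := hp0.trans hp0'.symm
    apply Subtype.ext
    apply Subtype.ext
    funext i
    fin_cases i <;> assumption
  have hb : Summable fun s : Bool => (1 : ℝ) := Summable.of_finite
  have hs := hb.mul_of_nonneg hw (fun _ => zero_le_one)
    (fun a => mul_nonneg (mul_nonneg (intWeight_nonneg _) (intWeight_nonneg _))
      (intWeight_nonneg _))
  refine Summable.of_nonneg_of_le 
    (fun _ => inv_nonneg.2 (pow_nonneg (add_nonneg zero_le_one (norm_nonneg _)) _)) ?_ (hs.comp_injective hι)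
  rintro ⟨⟨p, hp⟩, hp0⟩
  have hB : ∀ i, 1 + |(p i : ℝ)| ≤ 1 + ‖p‖ := fun i => by linarith [abs_coord_le_norm p i]
  have h0 : 1 + |((0 : ℤ) : ℝ)| ≤ 1 + ‖p‖ := by simp
  simp only [Function.comp_apply, ι]
  split_ifs
  · simpa using inv_pow_four_le_intWeight (hB 3) (hB 4) h0
  · simpa using inv_pow_four_le_intWeight (hB 1) (hB 2) (hB 4)

end SiegelEis

/-! ### Minors of coprime symmetric pairs -/

namespace SiegelEis

/-- The minor of a `2 × 4` matrix in the columns `i` and `j`. -/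
def minor {R : Type} [CommRing R] (W : Matrix (Fin 2) (Fin 2 ⊕ Fin 2) R) (i j : Fin 2 ⊕ Fin 2) : R :=
  W 0 i * W 1 j - W 0 j * W 1 i

/-- By Cauchy–Binet `det(W'X)` depends only on the minors of `W'`, so it equals `det(WX) = 1`. The
entries of `adj(W'X)W'` are also linear in the minors of `W'`, hence `adj(W'X)W' = adj(WX)W = W`. -/
lemma eq_mul_of_minor_eq {R : Type} [CommRing R] {W W' : Matrix (Fin 2) (Fin 2 ⊕ Fin 2) R}
    (h : ∀ i j, minor W i j = minor W' i j) {X : Matrix (Fin 2 ⊕ Fin 2) (Fin 2) R}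
    (hX : W * X = 1) : W' = (W' * X) * W ∧ (W' * X).det = 1 := by
  have e : ∀ i j, (W * X) i j = (1 : Mat2 R) i j := fun i j => by rw [hX]
  have e00 := e 0 0
  have e01 := e 0 1
  have e10 := e 1 0
  have e11 := e 1 1
  simp only [Matrix.mul_apply, Fintype.sum_sum_type, Fin.sum_univ_two, Matrix.one_apply_eq,
    Matrix.one_apply_ne one_ne_zero, Matrix.one_apply_ne zero_ne_one] at e00 e01 e10 e11
  have m : ∀ i j, W 0 i * W 1 j - W 0 j * W 1 i = W' 0 i * W' 1 j - W' 0 j * W' 1 i := h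
  have hdet : (W' * X).det = 1 := by
    have h1 : (W * X).det = 1 := by rw [hX, Matrix.det_one]
    rw [← h1]
    simp only [Matrix.det_fin_two, Matrix.mul_apply, Fintype.sum_sum_type, Fin.sum_univ_two]
    have c : ∀ i j, W' 0 i * W' 1 j - W' 0 j * W' 1 i = W 0 i * W 1 j - W 0 j * W 1 i :=
      fun i j => (m i j).symm
    let r := fun i j => X i 0 * X j 1 - X i 1 * X j 0
    linear_combination c (.inl 0) (.inl 1) * r (.inl 0) (.inl 1) +
      c (.inl 0) (.inr 0) * r (.inl 0) (.inr 0) + c (.inl 0) (.inr 1) * r (.inl 0) (.inr 1) +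
      c (.inl 1) (.inr 0) * r (.inl 1) (.inr 0) + c (.inl 1) (.inr 1) * r (.inl 1) (.inr 1) +
      c (.inr 0) (.inr 1) * r (.inr 0) (.inr 1)
  refine ⟨?_, hdet⟩
  have hadj : W = (W' * X).adjugate * W' := by
    rw [Matrix.adjugate_fin_two]
    ext i j
    have a0 := m j (.inl 0)
    have a1 := m j (.inl 1)
    have a2 := m j (.inr 0)
    have a3 := m j (.inr 1)
    fin_cases i <;>
      simp only [Matrix.mul_apply, Fintype.sum_sum_type, Fin.sum_univ_two, Fin.zero_eta,
        Fin.mk_one, Matrix.of_apply, Matrix.cons_val_zero, Matrix.cons_val_one,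
        Matrix.cons_val_fin_one]
    · linear_combination a0 * X (.inl 0) 1 + a1 * X (.inl 1) 1 + a2 * X (.inr 0) 1 +
        a3 * X (.inr 1) 1 - W 0 j * e11 + W 1 j * e01
    · linear_combination -a0 * X (.inl 0) 0 - a1 * X (.inl 1) 0 - a2 * X (.inr 0) 0 -
        a3 * X (.inr 1) 0 + W 0 j * e10 - W 1 j * e00
  calc W' = ((W' * X) * (W' * X).adjugate) * W' := by
        rw [Matrix.mul_adjugate, hdet, one_smul, Matrix.one_mul]
    _ = (W' * X) * W := by rw [Matrix.mul_assoc, ← hadj]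

/-- The five independent minors of a symmetric pair `(C D)`. -/
def pairMinors (W : Matrix (Fin 2) (Fin 2 ⊕ Fin 2) ℤ) : Fin 5 → ℤ :=
  ![minor W (.inl 0) (.inl 1), minor W (.inl 0) (.inr 1), minor W (.inl 0) (.inr 0),
    minor W (.inr 0) (.inl 1), minor W (.inr 0) (.inr 1)]

/-- `(C D)` is symmetric: `C Dᵀ = D Cᵀ`. -/
def IsSymmPair {R : Type} [CommRing R] (W : Matrix (Fin 2) (Fin 2 ⊕ Fin 2) R) : Prop :=
  minor W (.inl 0) (.inr 0) + minor W (.inl 1) (.inr 1) = 0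

/-- This is the Plücker relation, with the sixth minor eliminated by symmetry. -/
lemma pairMinors_mem_nullCone {W : Matrix (Fin 2) (Fin 2 ⊕ Fin 2) ℤ} (h : IsSymmPair W) :
    pairMinors W ∈ nullCone := by
  simp only [IsSymmPair, minor] at h
  simp [nullCone, pairMinors, minor]
  linear_combination (W 0 (.inl 0) * W 1 (.inr 0) - W 0 (.inr 0) * W 1 (.inl 0)) * h

lemma minor_eq_of_pairMinors_eq {W W' : Matrix (Fin 2) (Fin 2 ⊕ Fin 2) ℤ} (h : IsSymmPair W)
    (h' : IsSymmPair W') (hm : pairMinors W = pairMinors W') (i j : Fin 2 ⊕ Fin 2) :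
    minor W i j = minor W' i j := by
  have h0 := congrFun hm 0
  have h1 := congrFun hm 1
  have h2 := congrFun hm 2
  have h3 := congrFun hm 3
  have h4 := congrFun hm 4
  simp [pairMinors] at h0 h1 h2 h3 h4
  simp only [IsSymmPair] at h h'
  simp only [minor] at *
  rcases i with i | i <;> rcases j with j | j <;> fin_cases i <;> fin_cases j <;>
    simp only [Fin.zero_eta, Fin.mk_one] <;> linarith

/-! ### Bounding the minors by `det (Cτ + D)` -/

lemma exists_quadratic_lower_bound {Y : Mat2 ℝ} (hY : Y.PosDef) :
    ∃ l : ℝ, 0 < l ∧ ∀ x y : ℝ, l * (x ^ 2 + y ^ 2) ≤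
      Y 0 0 * x ^ 2 + 2 * Y 0 1 * x * y + Y 1 1 * y ^ 2 := by
  have hs : Y 1 0 = Y 0 1 := by
    have := hY.isHermitian.apply 0 1
    simpa using this
  have hd : 0 < Y 0 0 * Y 1 1 - Y 0 1 ^ 2 := by
    have := hY.det_pos
    rw [Matrix.det_fin_two, hs] at this
    linarith [sq (Y 0 1)]
  have h0 : 0 < Y 0 0 := hY.diag_pos
  have h1 : 0 < Y 1 1 := hY.diag_pos
  have ht : 0 < Y 0 0 + Y 1 1 := by linarith
  -- The constant is `det Y / tr Y`, which is below both eigenvalues: by Cayley–Hamilton `tr(Y) Y -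
  -- det(Y) = Y²`, whose quadratic form is the sum of the two squares given to `nlinarith`.
  refine ⟨(Y 0 0 * Y 1 1 - Y 0 1 ^ 2) / (Y 0 0 + Y 1 1), by positivity, fun x y => ?_⟩
  rw [div_mul_eq_mul_div, div_le_iff₀ ht]
  nlinarith [sq_nonneg (Y 0 0 * x + Y 0 1 * y), sq_nonneg (Y 0 1 * x + Y 1 1 * y)]

/-- `W` times the `4 × 2` matrix with blocks `τ` and `1`: the matrix `Cτ + D` if `W = (C D)`. -/
def autFactor (W : Matrix (Fin 2) (Fin 2 ⊕ Fin 2) ℂ) (τ : Mat2 ℂ) : Mat2 ℂ :=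
  W * (Matrix.fromRows τ 1 : Matrix (Fin 2 ⊕ Fin 2) (Fin 2) ℂ)

lemma autFactor_apply (W : Matrix (Fin 2) (Fin 2 ⊕ Fin 2) ℂ) (τ : Mat2 ℂ) (i j : Fin 2) :
    autFactor W τ i j =
      W i (.inl 0) * τ 0 j + W i (.inl 1) * τ 1 j + W i (.inr j) := by
  fin_cases j <;>
  simp [autFactor, Matrix.mul_apply, Fintype.sum_sum_type, Fin.sum_univ_two, Matrix.one_apply]

/-- Put `u = wC`, `v = wD`, so that `w(Cτ + D) = uτ + v`. Since `CDᵀ` is real symmetric, `u v*` is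
real, and the right-hand side is exactly the Hermitian form `u Y u*` with `Y = Im τ`. -/
lemma quadratic_le_im {W : Matrix (Fin 2) (Fin 2 ⊕ Fin 2) ℂ} (hW : IsSymmPair W)
    (hre : ∀ i j, (W i j).im = 0) {τ : Mat2 ℂ} (hτ : τᵀ = τ) {l : ℝ}
    (hl : ∀ x y : ℝ, l * (x ^ 2 + y ^ 2) ≤
      (τ 0 0).im * x ^ 2 + 2 * (τ 0 1).im * x * y + (τ 1 1).im * y ^ 2) (w : Fin 2 → ℂ) :
    l * (Complex.normSq ((w ᵥ* W) (.inl 0)) + Complex.normSq ((w ᵥ* W) (.inl 1))) ≤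
      -((w ᵥ* W) (.inl 0) * (starRingEnd ℂ) ((w ᵥ* autFactor W τ) 0) +
        (w ᵥ* W) (.inl 1) * (starRingEnd ℂ) ((w ᵥ* autFactor W τ) 1)).im := by
  have hs : τ 1 0 = τ 0 1 := congrFun (congrFun hτ 0) 1
  set u0 := (w ᵥ* W) (.inl 0) with hu0
  set u1 := (w ᵥ* W) (.inl 1) with hu1
  set v0 := (w ᵥ* W) (.inr 0) with hv0
  set v1 := (w ᵥ* W) (.inr 1) with hv1
  have hz0 : (w ᵥ* autFactor W τ) 0 = u0 * τ 0 0 + u1 * τ 0 1 + v0 := by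
    simp only [Matrix.vecMul, dotProduct, Fin.sum_univ_two, autFactor_apply, hu0, hu1, hv0, hs]
    ring
  have hz1 : (w ᵥ* autFactor W τ) 1 = u0 * τ 0 1 + u1 * τ 1 1 + v1 := by
    simp only [Matrix.vecMul, dotProduct, Fin.sum_univ_two, autFactor_apply, hu0, hu1, hv1]
    ring
  have huv : (u0 * (starRingEnd ℂ) v0 + u1 * (starRingEnd ℂ) v1).im = 0 := by
    have h2 := congrArg Complex.re hW
    simp only [minor, Complex.add_re, Complex.sub_re, Complex.mul_re, hre, mul_zero, sub_zero,
      Complex.zero_re] at h2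
    simp only [hu0, hu1, hv0, hv1, Matrix.vecMul, dotProduct, Fin.sum_univ_two, Complex.add_im,
      Complex.mul_im, Complex.conj_re, Complex.conj_im, Complex.add_re, Complex.mul_re, hre]
    linear_combination ((w 0).im * (w 1).re - (w 0).re * (w 1).im) * h2
  rw [hz0, hz1]
  have h1 := hl u0.re u1.re
  have h2 := hl u0.im u1.im
  simp only [Complex.add_im, Complex.mul_im, Complex.conj_re, Complex.conj_im, Complex.add_re,
    Complex.mul_re, Complex.normSq_apply] at huv ⊢
  linear_combination h1 + h2 + huv

/-- If `w(Cτ + D) = 0`, the quadratic inequality forces `wC = 0`, then `wD = 0`, and the right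
inverse gives `w = 0`. -/
lemma isUnit_det_autFactor {W : Matrix (Fin 2) (Fin 2 ⊕ Fin 2) ℂ} (hW : IsSymmPair W)
    (hre : ∀ i j, (W i j).im = 0) {X : Matrix (Fin 2 ⊕ Fin 2) (Fin 2) ℂ} (hX : W * X = 1)
    {τ : Mat2 ℂ} (hτ : τ ∈ siegelHalfSpace) : (autFactor W τ).det ≠ 0 := by
  obtain ⟨l, hl, hq⟩ := exists_quadratic_lower_bound hτ.2
  intro h0
  obtain ⟨w, hw, hz⟩ := Matrix.exists_vecMul_eq_zero_iff.2 h0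
  have h := quadratic_le_im hW hre hτ.1 hq w
  simp only [hz, Pi.zero_apply, map_zero, mul_zero, add_zero, Complex.zero_im, neg_zero] at h
  have n0 := Complex.normSq_nonneg ((w ᵥ* W) (.inl 0))
  have n1 := Complex.normSq_nonneg ((w ᵥ* W) (.inl 1))
  have u0 : (w ᵥ* W) (.inl 0) = 0 := Complex.normSq_eq_zero.1 (by nlinarith)
  have u1 : (w ᵥ* W) (.inl 1) = 0 := Complex.normSq_eq_zero.1 (by nlinarith)
  have hv : ∀ j, (w ᵥ* W) (.inr j) = 0 := by
    intro j
    have h1 := congrFun hz j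
    simp only [Matrix.vecMul, dotProduct, Fin.sum_univ_two, autFactor_apply,
      Pi.zero_apply] at h1 u0 u1 ⊢
    linear_combination h1 - τ 0 j * u0 - τ 1 j * u1
  have hwW : w ᵥ* W = 0 := by
    funext j
    rcases j with j | j
    · fin_cases j
      exacts [u0, u1]
    · exact hv j
  apply hw
  rw [← Matrix.vecMul_one w, ← hX, ← Matrix.vecMul_vecMul, hwW, Matrix.zero_vecMul]

lemma minor_mul {R : Type} [CommRing R] (Z : Mat2 R) (W : Matrix (Fin 2) (Fin 2 ⊕ Fin 2) R)
    (i j : Fin 2 ⊕ Fin 2) : minor (Z * W) i j = Z.det * minor W i j := by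
  simp only [minor, Matrix.mul_apply, Fin.sum_univ_two, Matrix.det_fin_two]
  ring

/-- With `Z = Cτ + D`, the minors of `W` are `det Z` times those of `Q = Z⁻¹W`, so it is enough to
bound the entries of `Q` in terms of `τ` alone. -/
lemma exists_minor_le {τ : Mat2 ℂ} (hτ : τ ∈ siegelHalfSpace) :
    ∃ K : ℝ, 0 < K ∧ ∀ (W : Matrix (Fin 2) (Fin 2 ⊕ Fin 2) ℂ), IsSymmPair W →
      (∀ i j, (W i j).im = 0) → (autFactor W τ).det ≠ 0 →
      ∀ i j, ‖minor W i j‖ ≤ K * ‖(autFactor W τ).det‖ := by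
  obtain ⟨l, hl, hq⟩ := exists_quadratic_lower_bound hτ.2
  set T : ℝ := ∑ i, ∑ j, ‖τ i j‖ with hT
  have hT0 : 0 ≤ T := by positivity
  have hTij : ∀ i j, ‖τ i j‖ ≤ T := fun i j =>
    (Finset.single_le_sum (f := fun j => ‖τ i j‖) (fun _ _ => norm_nonneg _)
      (Finset.mem_univ j)).trans
    (Finset.single_le_sum (f := fun i => ∑ j, ‖τ i j‖)
      (fun _ _ => Finset.sum_nonneg fun _ _ => norm_nonneg _) (Finset.mem_univ i))
  set B : ℝ := 1 + l⁻¹ + 2 * l⁻¹ * T with hB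
  have hl' : 0 < l⁻¹ := inv_pos.2 hl
  have hB0 : 0 < B := by positivity
  refine ⟨2 * B ^ 2, by positivity, fun W hW hre hdet i j => ?_⟩
  set Z := autFactor W τ with hZ
  have hZu : IsUnit Z.det := isUnit_iff_ne_zero.2 hdet
  have hWZ : W = Z * (Z⁻¹ * W) := by
    rw [← Matrix.mul_assoc, Matrix.mul_nonsing_inv _ hZu, Matrix.one_mul]
  set Q := Z⁻¹ * W with hQ
  have hQl : ∀ i j, ‖Q i (.inl j)‖ ≤ l⁻¹ := by
    intro i j
    -- For `w` the `i`-th row of `Z⁻¹`, `wZ` is a unit vector and the inequality reads `l s ≤ -Im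
    -- Q_ii ≤ √s`, which bounds `s`.
    have h := quadratic_le_im hW hre hτ.1 hq (Z⁻¹ i)
    have h1 : ∀ j, (Z⁻¹ i ᵥ* W) j = Q i j := fun j => by
      rw [hQ, Matrix.mul_apply_eq_vecMul]
    have h2 : ∀ j, (Z⁻¹ i ᵥ* Z) j = (1 : Mat2 ℂ) i j := fun j => by
      rw [← Matrix.nonsing_inv_mul _ hZu, Matrix.mul_apply_eq_vecMul]
    rw [← hZ] at h
    simp only [h1, h2] at h
    set s := Complex.normSq (Q i (.inl 0)) + Complex.normSq (Q i (.inl 1)) with hs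
    have n0 := Complex.normSq_nonneg (Q i (.inl 0))
    have n1 := Complex.normSq_nonneg (Q i (.inl 1))
    have h3 : l * s ≤ ‖Q i (.inl i)‖ := by
      have h4 : -(Q i (.inl i)).im ≤ ‖Q i (.inl i)‖ :=
        (neg_le_abs _).trans (Complex.abs_im_le_norm _)
      refine h.trans (le_trans (le_of_eq ?_) h4)
      rcases Fin.exists_fin_two.1 ⟨i, rfl⟩ with rfl | rfl <;> simp
    have h5 : ∀ j, ‖Q i (.inl j)‖ ^ 2 ≤ s := by
      intro j
      rw [← Complex.normSq_eq_norm_sq]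
      fin_cases j <;> simp only [hs, Fin.zero_eta, Fin.mk_one] <;> linarith
    have h6 : ‖Q i (.inl i)‖ ≤ l⁻¹ := by
      rw [← one_div, le_div_iff₀ hl]
      by_contra! hc
      have := h5 i
      have hpos : 0 < ‖Q i (.inl i)‖ := by
        by_contra! hn
        nlinarith [norm_nonneg (Q i (.inl i))]
      nlinarith
    have h7 : s ≤ l⁻¹ ^ 2 := by
      have : l⁻¹ * (l * s) ≤ l⁻¹ * l⁻¹ := by gcongr; exact h3.trans h6
      rw [inv_mul_cancel_left₀ hl.ne'] at this
      linarith [sq l⁻¹]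
    exact abs_le_of_sq_le_sq' ((h5 j).trans h7) hl'.le |>.2
  -- The right block of `Q` follows from the left one, because `Q` has automorphy factor `1`.
  have hQr : ∀ i j, Q i (.inr j) = (1 : Mat2 ℂ) i j - Q i (.inl 0) * τ 0 j - Q i (.inl 1) * τ 1 j := by
    intro i j
    have h1 : autFactor Q τ = 1 := by
      rw [autFactor, hQ, Matrix.mul_assoc, ← autFactor, ← hZ, Matrix.nonsing_inv_mul _ hZu]
    rw [← h1, autFactor_apply]
    ring
  have hQB : ∀ i j, ‖Q i j‖ ≤ B := by
    intro i j
    rcases j with j | j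
    · refine (hQl i j).trans ?_
      rw [hB]
      have : 0 ≤ 2 * l⁻¹ * T := by positivity
      linarith
    · rw [hQr]
      have h1 : ‖(1 : Mat2 ℂ) i j‖ ≤ 1 := by
        rw [Matrix.one_apply]; split_ifs <;> simp
      have h2 : ∀ k, ‖Q i (.inl k) * τ k j‖ ≤ l⁻¹ * T := fun k => by
        rw [norm_mul]
        exact mul_le_mul (hQl i k) (hTij k j) (norm_nonneg _) hl'.le
      calc _ ≤ ‖(1 : Mat2 ℂ) i j‖ + ‖Q i (.inl 0) * τ 0 j‖ + ‖Q i (.inl 1) * τ 1 j‖ :=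
            (norm_sub_le _ _).trans (by gcongr; exact norm_sub_le _ _)
        _ ≤ 1 + l⁻¹ * T + l⁻¹ * T := by gcongr; exacts [h2 0, h2 1]
        _ ≤ B := by rw [hB]; linarith
  rw [hWZ, minor_mul, norm_mul, mul_comm]
  have hm : ‖minor Q i j‖ ≤ 2 * B ^ 2 := by
    rw [minor]
    calc _ ≤ ‖Q 0 i * Q 1 j‖ + ‖Q 0 j * Q 1 i‖ := norm_sub_le _ _
      _ ≤ B * B + B * B := by
          rw [norm_mul, norm_mul]
          gcongr <;> exact hQB _ _
      _ = _ := by ring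
  gcongr

end SiegelEis

/-! ### Absolute convergence of the Eisenstein series -/

namespace SiegelEis

/-- `W J Wᵀ` is an alternating 2 × 2 matrix, so one entry decides; in this form symplectic
invariance is immediate. -/
lemma isSymmPair_iff_mul_J {R : Type} [CommRing R] (W : Matrix (Fin 2) (Fin 2 ⊕ Fin 2) R) :
    IsSymmPair W ↔ W * Matrix.J (Fin 2) R * Wᵀ = (0 : Matrix (Fin 2) (Fin 2) R) := by
  constructor
  · intro h
    simp only [IsSymmPair, minor] at h
    ext i j
    fin_cases i <;> fin_cases j <;>
      simp [Matrix.mul_apply, Fin.sum_univ_two, Matrix.J, Matrix.one_apply]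
    · ring
    · linear_combination -h
    · linear_combination h
    · ring
  · intro h
    have := congrFun (congrFun h 0) 1
    simp [Matrix.mul_apply, Fin.sum_univ_two, Matrix.J, Matrix.one_apply] at this
    simp only [IsSymmPair, minor]
    linear_combination -this

lemma IsSymmPair.mul {R : Type} [CommRing R] {W : Matrix (Fin 2) (Fin 2 ⊕ Fin 2) R}
    (h : IsSymmPair W) {g : Mat4 R} (hg : g ∈ Matrix.symplecticGroup (Fin 2) R) :
    IsSymmPair (W * g : Matrix (Fin 2) (Fin 2 ⊕ Fin 2) R) := by
  rw [isSymmPair_iff_mul_J] at h ⊢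
  have hg := SymplecticGroup.mem_iff.1 hg
  calc W * g * Matrix.J (Fin 2) R * (W * g)ᵀ = W * (g * Matrix.J (Fin 2) R * gᵀ) * Wᵀ := by
        simp only [Matrix.transpose_mul, Matrix.mul_assoc]
    _ = 0 := by rw [hg, h]

lemma IsSymmPair.map {R S : Type} [CommRing R] [CommRing S]
    {W : Matrix (Fin 2) (Fin 2 ⊕ Fin 2) R} (h : IsSymmPair W) (f : R →+* S) :
    IsSymmPair (W.map f) := by
  have := congrArg f h
  simpa [IsSymmPair, minor] using this

/-- The pair `(M I)` as a `2 × 4` matrix. -/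
def cuspRow (M : Mat2 ℤ) : Matrix (Fin 2) (Fin 2 ⊕ Fin 2) ℤ := Matrix.fromCols M 1

/-- The pair `(M I)γ` as a `2 × 4` matrix. -/
def pairRow (M : Mat2 ℤ) (γ : Sp2Z) : Matrix (Fin 2) (Fin 2 ⊕ Fin 2) ℤ :=
  cuspRow M * (γ : Mat4 ℤ)

lemma cuspMul_inr (M : Mat2 ℤ) (γ : Sp2Z) (i : Fin 2) (j : Fin 2 ⊕ Fin 2) :
    cuspMul M γ (.inr i) j = pairRow M γ i j := by
  simp [cuspMul, pairRow, cuspRow, Matrix.mul_apply]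

lemma toBlocks₂₁_cuspMul (M : Mat2 ℤ) (γ : Sp2Z) :
    (cuspMul M γ).toBlocks₂₁ = (pairRow M γ).toCols₁ := by
  ext i j
  exact cuspMul_inr M γ i (.inl j)

lemma toBlocks₂₂_cuspMul (M : Mat2 ℤ) (γ : Sp2Z) :
    (cuspMul M γ).toBlocks₂₂ = (pairRow M γ).toCols₂ := by
  ext i j
  exact cuspMul_inr M γ i (.inr j)

lemma pairSetoid_iff {N : ℕ} {M : Mat2 ℤ} {γ γ' : Gamma0 N} :
    pairSetoid N M γ γ' ↔ ∃ G : SL(2, ℤ), pairRow M γ' = (G : Mat2 ℤ) * pairRow M γ := by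
  change (∃ G : SL(2, ℤ), _ ∧ _) ↔ _
  simp only [toBlocks₂₁_cuspMul, toBlocks₂₂_cuspMul]
  refine exists_congr fun G => ⟨fun ⟨h1, h2⟩ => ?_, fun h => ?_⟩
  · ext i j
    rcases j with j | j
    · exact congrFun (congrFun h1 i) j
    · exact congrFun (congrFun h2 i) j
  · rw [h]
    exact ⟨rfl, rfl⟩

lemma isSymmPair_pairRow {M : Mat2 ℤ} (hM : M.IsDiag) (γ : Sp2Z) : IsSymmPair (pairRow M γ) := by
  refine IsSymmPair.mul ?_ γ.2
  simp [IsSymmPair, minor, cuspRow, hM zero_ne_one, hM one_ne_zero]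

lemma exists_pairRow_mul_eq_one (M : Mat2 ℤ) (γ : Sp2Z) :
    ∃ X : Matrix (Fin 2 ⊕ Fin 2) (Fin 2) ℤ, pairRow M γ * X = 1 := by
  refine ⟨((γ⁻¹ : Sp2Z) : Mat4 ℤ) * (Matrix.fromRows 0 1 : Matrix (Fin 2 ⊕ Fin 2) (Fin 2) ℤ), ?_⟩
  have h : (γ : Mat4 ℤ) * ((γ⁻¹ : Sp2Z) : Mat4 ℤ) = 1 :=
    congrArg (fun x : Sp2Z => (x : Mat4 ℤ)) (mul_inv_cancel γ)
  rw [pairRow, Matrix.mul_assoc, ← Matrix.mul_assoc (γ : Mat4 ℤ), h, Matrix.one_mul, cuspRow,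
    Matrix.fromCols_mul_fromRows]
  simp

lemma pairSetoid_of_pairMinors_eq {N : ℕ} {M : Mat2 ℤ} (hM : M.IsDiag) {γ γ' : Gamma0 N}
    (h : pairMinors (pairRow M γ) = pairMinors (pairRow M γ')) : pairSetoid N M γ γ' := by
  obtain ⟨X, hX⟩ := exists_pairRow_mul_eq_one M γ
  obtain ⟨h1, h2⟩ := eq_mul_of_minor_eq (minor_eq_of_pairMinors_eq
    (isSymmPair_pairRow hM _) (isSymmPair_pairRow hM _) h) hX
  exact pairSetoid_iff.2 ⟨⟨_, h2⟩, h1⟩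

lemma eisTerm_eq (N k : ℕ) (χ : DirichletCharacter ℂ N) (M : Mat2 ℤ) (γ : Sp2Z) (τ : Mat2 ℂ) :
    eisTerm N k χ M γ τ = (starRingEnd ℂ) (χ ((blockD γ).det : ZMod N)) *
      ((autFactor ((pairRow M γ).map (Int.castRingHom ℂ)) τ).det ^ k)⁻¹ := by
  rw [eisTerm]
  congr 4
  ext i j
  rw [autFactor_apply, toBlocks₂₁_cuspMul, toBlocks₂₂_cuspMul]
  simp [Matrix.mul_apply, Fin.sum_univ_two, Matrix.toCols₁, Matrix.toCols₂]

lemma det_autFactor_pairRow_ne_zero {M : Mat2 ℤ} (hM : M.IsDiag) (γ : Sp2Z) {τ : Mat2 ℂ}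
    (hτ : τ ∈ siegelHalfSpace) :
    (autFactor ((pairRow M γ).map (Int.castRingHom ℂ)) τ).det ≠ 0 := by
  obtain ⟨X, hX⟩ := exists_pairRow_mul_eq_one M γ
  refine isUnit_det_autFactor ((isSymmPair_pairRow hM γ).map _) (fun i j => by simp)
    (X := X.map (Int.castRingHom ℂ)) ?_ hτ
  rw [← Matrix.map_mul, hX]
  simp

lemma pairMinors_ne_zero {M : Mat2 ℤ} (hM : M.IsDiag) (γ : Sp2Z) :
    pairMinors (pairRow M γ) ≠ 0 := by
  intro h
  obtain ⟨X, hX⟩ := exists_pairRow_mul_eq_one M γ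
  have h0 : IsSymmPair (0 : Matrix (Fin 2) (Fin 2 ⊕ Fin 2) ℤ) := by simp [IsSymmPair, minor]
  have hm : pairMinors (pairRow M γ) = pairMinors 0 := by
    rw [h]
    ext i
    fin_cases i <;> simp [pairMinors, minor]
  have := (eq_mul_of_minor_eq (minor_eq_of_pairMinors_eq
    (isSymmPair_pairRow hM γ) h0 hm) hX).2
  simp at this

theorem summable_eisTerm (N k : ℕ) (hk : 4 ≤ k) (χ : DirichletCharacter ℂ N) {M : Mat2 ℤ}
    (hM : M.IsDiag) {τ : Mat2 ℂ} (hτ : τ ∈ siegelHalfSpace) :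
    Summable fun c : PairClass N M => eisTerm N k χ M (c.out : Gamma0 N) τ := by
  obtain ⟨K, hK, hbound⟩ := exists_minor_le hτ
  let ι : PairClass N M → nullCone := fun c =>
    ⟨pairMinors (pairRow M (c.out : Gamma0 N)), pairMinors_mem_nullCone (isSymmPair_pairRow hM _)⟩
  have hι : Function.Injective ι := by
    intro c c' h
    rw [← Quotient.out_equiv_out]
    exact pairSetoid_of_pairMinors_eq hM (congrArg Subtype.val h)
  refine Summable.of_norm_bounded
    (((summable_nullCone.comp_injective hι).mul_left ((2 * K) ^ k))) fun c => ?_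
  set γ : Sp2Z := ((c.out : Gamma0 N) : Sp2Z) with hγ
  set p := pairMinors (pairRow M γ) with hp
  set d := (autFactor ((pairRow M γ).map (Int.castRingHom ℂ)) τ).det with hd
  have hd0 : d ≠ 0 := det_autFactor_pairRow_ne_zero hM γ hτ
  have hpd : ‖p‖ ≤ K * ‖d‖ := by
    rw [pi_norm_le_iff_of_nonneg (by positivity)]
    have h := hbound _ ((isSymmPair_pairRow hM γ).map (Int.castRingHom ℂ)) (fun i j => by simp) hd0
    have hm : ∀ i j, ‖minor (pairRow M γ) i j‖ ≤ K * ‖d‖ := by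
      intro i j
      refine le_trans (le_of_eq ?_) (h i j)
      have : minor ((pairRow M γ).map (Int.castRingHom ℂ)) i j =
          ((minor (pairRow M γ) i j : ℤ) : ℂ) := by
        simp [minor]
      rw [this, Complex.norm_intCast, Int.norm_eq_abs]
    intro i
    fin_cases i <;> exact hm _ _
  -- A nonzero integral vector has norm at least 1, so `1 + ‖p‖ ≤ 2‖p‖ ≤ 2K‖d‖`; hence the constant
  -- `(2K)^k`.
  have hp1 : 1 ≤ ‖p‖ := by
    obtain ⟨i, hi⟩ := Function.ne_iff.1 (pairMinors_ne_zero hM γ)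
    refine le_trans ?_ (abs_coord_le_norm p i)
    have : (1 : ℤ) ≤ |p i| := Int.one_le_abs hi
    exact_mod_cast this
  have hd1 : 0 < ‖d‖ := norm_pos_iff.2 hd0
  rw [eisTerm_eq, norm_mul, norm_inv, norm_pow, ← hd, RCLike.norm_conj]
  calc _ ≤ 1 * (‖d‖ ^ k)⁻¹ := by
        gcongr
        exact DirichletCharacter.norm_le_one χ _
    _ ≤ (2 * K) ^ k * ((1 + ‖p‖) ^ k)⁻¹ := by
        rw [one_mul, inv_le_iff_one_le_mul₀ (by positivity), mul_right_comm,
          ← div_eq_mul_inv, le_div_iff₀ (by positivity), one_mul, ← mul_pow]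
        gcongr
        linarith
    _ ≤ (2 * K) ^ k * ((1 + ‖p‖) ^ 4)⁻¹ := by
        gcongr
        linarith

end SiegelEis

/-! ### Unfolding a double coset sum -/

namespace SiegelEis

/-- Let `R k k'` be the relation `k δ = δ k'` on a group `Γ`, and let `H` be a subgroup which is
the intersection of `Γ` with a group normalized by `δ⁻¹σ`. If `Γ = H (Γ ∩ δ⁻¹Γδ)`, a sum over
`H \ Γ × (Γ ∩ δΓδ⁻¹) \ Γ` unfolds to a multiple of a sum over `H \ Γ`. -/
theorem finsum_tsum_rightCosets {Γ ι : Type*} [Group Γ] [Fintype ι] {H K : Subgroup Γ}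
    {s : Setoid Γ} (hs : ∀ x y, s x y ↔ y * x⁻¹ ∈ H) {R : Γ → Γ → Prop}
    (hK : ∀ k, k ∈ K ↔ ∃ k', R k k')
    (hmul : ∀ {k k' l l'}, R k k' → R l l' → R (k * l) (k' * l'))
    (hinv : ∀ {k k'}, R k k' → R k⁻¹ k'⁻¹) {σ : Γ}
    (hσ : ∀ {x k'}, R (σ * x * σ⁻¹) k' → (x ∈ H ↔ k' ∈ H))
    (htrans : ∀ γ, ∃ h ∈ H, ∃ k k', R k k' ∧ γ = h * k')
    {rep : ι → Γ} (hrep : ∀ i, rep i ∈ H)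
    (hrepK : ∀ h ∈ H, ∃! i, σ * (h * (rep i)⁻¹) * σ⁻¹ ∈ K)
    [Finite (Quotient (QuotientGroup.rightRel K))]
    {F : Γ → Γ → ℂ} {f : Γ → ℂ} {a : ℂ}
    (hF : ∀ h ∈ H, ∀ γ₁ γ₂, F (h * γ₁) γ₂ = F γ₁ γ₂) (hf : ∀ h ∈ H, ∀ γ, f (h * γ) = f γ)
    (hFf : ∀ {k k'}, R k k' → ∀ γ₂, F k' γ₂ = a * f (σ⁻¹ * (k * γ₂)))
    (hsum : Summable fun c : Quotient s => f c.out) :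
    ∑ᶠ κ : Quotient (QuotientGroup.rightRel K), ∑' c : Quotient s, F c.out κ.out =
      a * Fintype.card ι * ∑' c : Quotient s, f c.out := by
  -- `R` is not assumed to be single-valued; a partner unique up to left multiplication by `H` is
  -- enough.
  have hR1 : ∀ {k k' k''}, R k k' → R k k'' → k'' * k'⁻¹ ∈ H := fun {k k' k''} h h' => by
    have := hmul h' (hinv h)
    rw [mul_inv_cancel] at this
    exact (hσ (x := 1) (by simpa using this)).1 H.one_mem
  have hmk : ∀ x y, (Quotient.mk s x = Quotient.mk s y) ↔ y * x⁻¹ ∈ H := fun x y =>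
    Quotient.eq.trans (hs x y)
  have hmkK : ∀ x y, (Quotient.mk (QuotientGroup.rightRel K) x =
      Quotient.mk (QuotientGroup.rightRel K) y) ↔ y * x⁻¹ ∈ K := fun x y =>
    Quotient.eq.trans QuotientGroup.rightRel_apply
  let Q := Quotient (QuotientGroup.rightRel K)
  let cl : Γ → Q := Quotient.mk _
  -- the second component of the image of `γ`, and the element `k` with `k * κ.out = σ * γ`
  have hk : ∀ γ, σ * γ * (cl (σ * γ)).out⁻¹ ∈ K := fun γ => by
    rw [← hmkK]
    exact Quotient.out_eq _
  choose φ hφ using fun γ => (hK _).1 (hk γ)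
  -- For `γ = rep i * c.out`, let `κ` be the `K`-coset of `σγ` and write `σγ = k κ.out`. The partner
  -- `k'` of `k` gives the class `Hk'` paired with `κ`, and `F k' κ.out = a f(γ)`.
  let L : Quotient s × ι → Quotient s × Q := fun x =>
    (Quotient.mk s (φ (rep x.2 * x.1.out)), cl (σ * (rep x.2 * x.1.out)))
  have hL : Function.Bijective L := by
    constructor
    · rintro ⟨c, i⟩ ⟨c', i'⟩ h
      simp only [L, Prod.mk.injEq] at h
      obtain ⟨h1, h2⟩ := h
      set γ := rep i * c.out with hγ
      set γ' := rep i' * c'.out with hγ'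
      rw [hmk] at h1
      have e1 := hφ γ
      have e2 := hφ γ'
      rw [← h2] at e2
      have e3 := hmul e2 (hinv e1)
      have e4 : σ * γ' * (cl (σ * γ)).out⁻¹ * (σ * γ * (cl (σ * γ)).out⁻¹)⁻¹ =
          σ * (γ' * γ⁻¹) * σ⁻¹ := by group
      rw [e4] at e3
      have e5 : γ' * γ⁻¹ ∈ H := (hσ e3).2 h1
      have hcc : c = c' := by
        rw [← Quotient.out_eq c, ← Quotient.out_eq c', hmk]
        have := H.mul_mem (H.mul_mem (H.inv_mem (hrep i')) e5) (hrep i)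
        rw [hγ, hγ'] at this
        convert this using 1
        group
      subst hcc
      have e6 : γ' * γ⁻¹ = rep i' * (rep i)⁻¹ := by rw [hγ, hγ']; group
      rw [e6] at e3
      obtain ⟨j, -, hj⟩ := hrepK _ (hrep i')
      have h3 := hj i ((hK _).2 ⟨_, e3⟩)
      have h4 := hj i' (by simp only [mul_inv_cancel, mul_one]; exact K.one_mem)
      rw [h3, h4]
    -- Since `Γ = H (Γ ∩ δ⁻¹Γδ)`, the class `c₁` has a representative `k'` with partner `k`. Then `γ
    -- = σ⁻¹ k κ.out` gives the class `c`, and `hrepK` picks the `i` for which `rep i * c.out` falls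
    -- in the right `K`-coset.
    · rintro ⟨c₁, κ⟩
      obtain ⟨h, hh, k, k', hkk, hc⟩ := htrans c₁.out
      set γ := σ⁻¹ * (k * κ.out) with hγ
      set c := Quotient.mk s γ with hcdef
      have hcγ : γ * c.out⁻¹ ∈ H := by
        rw [← hmk]
        exact Quotient.out_eq _
      obtain ⟨i, hi, -⟩ := hrepK _ hcγ
      refine ⟨(c, i), ?_⟩
      set γ₂ := rep i * c.out with hγ₂
      have e1 : γ * c.out⁻¹ * (rep i)⁻¹ = γ * γ₂⁻¹ := by rw [hγ₂]; group
      rw [e1] at hi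
      have hH : γ * γ₂⁻¹ ∈ H := by
        rw [← e1]
        exact H.mul_mem hcγ (H.inv_mem (hrep i))
      have hκ : cl (σ * γ₂) = κ := by
        rw [← Quotient.out_eq κ]
        rw [hmkK]
        have := K.mul_mem (K.inv_mem ((hK k).2 ⟨k', hkk⟩)) hi
        rw [hγ] at this
        convert this using 1
        group
      obtain ⟨x, hx⟩ := (hK _).1 hi
      have hxH : x ∈ H := (hσ hx).1 hH
      have e2 := hφ γ₂
      rw [hκ] at e2
      have e3 := hmul (hinv hx) hkk
      have e4 : (σ * (γ * γ₂⁻¹) * σ⁻¹)⁻¹ * k = σ * γ₂ * κ.out⁻¹ := by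
        rw [hγ]; group
      rw [e4] at e3
      simp only [L]
      rw [Prod.mk.injEq]
      refine ⟨?_, hκ⟩
      rw [← Quotient.out_eq c₁, hmk, hc]
      have e5 := hR1 e2 e3
      have e6 := H.mul_mem (H.mul_mem hh hxH) e5
      convert e6 using 1
      rw [hγ₂]
      group
  let E := Equiv.ofBijective L hL
  let G : Quotient s × Q → ℂ := fun x => F x.1.out x.2.out
  have hGL : ∀ x, G (E x) = (a * f x.1.out) * 1 := by
    rintro ⟨c, i⟩
    change F (Quotient.mk s (φ (rep i * c.out))).out (cl (σ * (rep i * c.out))).out = _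
    set γ := rep i * c.out with hγ
    set x := (Quotient.mk s (φ γ)).out with hx
    have h1 : φ γ * x⁻¹ ∈ H := by
      rw [← hmk]
      exact Quotient.out_eq _
    have h2 := hF _ h1 x (cl (σ * γ)).out
    rw [inv_mul_cancel_right, hFf (hφ γ)] at h2
    rw [← h2, mul_one, inv_mul_cancel_right, inv_mul_cancel_left, hγ, hf _ (hrep i)]
  -- Absolute convergence over `Quotient s × ι` is what permits reindexing along `E` and exchanging
  -- the sums.
  have hone : Summable fun _ : ι => ‖(1 : ℂ)‖ := Summable.of_finite
  have hsum' : Summable fun c : Quotient s => ‖a * f c.out‖ := (hsum.mul_left a).norm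
  have hGs : Summable G := by
    rw [← E.summable_iff]
    exact (summable_mul_of_summable_norm hsum' hone).congr fun x => (hGL x).symm
  have hGt : ∑' x, G x = a * Fintype.card ι * ∑' c : Quotient s, f c.out := by
    rw [← E.tsum_eq, tsum_congr hGL, ← tsum_mul_tsum_of_summable_norm hsum' hone, tsum_mul_left]
    simp
    ring
  have : Fintype Q := Fintype.ofFinite _
  rw [finsum_eq_sum_of_fintype, ← tsum_fintype (L := .unconditional _), ← hGt,
    ← (Equiv.prodComm Q (Quotient s)).tsum_eq G]
  exact (((Equiv.prodComm Q (Quotient s)).summable_iff.2 hGs).tsum_prod).symm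

end SiegelEis

/-! ### Conjugation by `δ₁` -/

namespace SiegelEis

/-- The underlying integral matrix. -/
abbrev mat {N : ℕ} (γ : Gamma0 N) : Mat4 ℤ := ((γ : Sp2Z) : Mat4 ℤ)

/-- The relation `k δ₁ = δ₁ k'`. -/
def DeltaConj (N q : ℕ) (k k' : Gamma0 N) : Prop := toRat k * delta1 q = delta1 q * toRat k'

lemma mem_conjInter {N q : ℕ} {k : Gamma0 N} :
    k ∈ conjInter N (delta1 q) ↔ ∃ k', DeltaConj N q k k' := Iff.rfl

lemma DeltaConj.mul {N q : ℕ} {k k' l l' : Gamma0 N} (h : DeltaConj N q k k')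
    (h' : DeltaConj N q l l') : DeltaConj N q (k * l) (k' * l') := by
  unfold DeltaConj at *
  rw [toRat_mul, toRat_mul, Matrix.mul_assoc, h', ← Matrix.mul_assoc, h, Matrix.mul_assoc]

lemma toRat_one (N : ℕ) : toRat (1 : Gamma0 N) = 1 := by simp [toRat]

lemma DeltaConj.inv {N q : ℕ} {k k' : Gamma0 N} (h : DeltaConj N q k k') :
    DeltaConj N q k⁻¹ k'⁻¹ := by
  unfold DeltaConj at *
  have ha : toRat (k⁻¹ : Gamma0 N) * toRat k = 1 := by
    rw [← toRat_mul, inv_mul_cancel, toRat_one]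
  have hb : toRat k' * toRat (k'⁻¹ : Gamma0 N) = 1 := by
    rw [← toRat_mul, mul_inv_cancel, toRat_one]
  calc toRat (k⁻¹ : Gamma0 N) * delta1 q
      = toRat (k⁻¹ : Gamma0 N) * (delta1 q * toRat k') * toRat (k'⁻¹ : Gamma0 N) := by
        rw [Matrix.mul_assoc, Matrix.mul_assoc, hb, Matrix.mul_one]
    _ = _ := by rw [← h, ← Matrix.mul_assoc, ha, Matrix.one_mul]

/-- The diagonal entries of `δ₁`. -/
def deltaDiag (q : ℕ) : Fin 2 ⊕ Fin 2 → ℚ := Sum.elim ![(q : ℚ), 1] ![(q : ℚ)⁻¹, 1]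

lemma delta1_eq_diagonal (q : ℕ) : delta1 q = Matrix.diagonal (deltaDiag q) := by
  ext i j
  rcases i with i | i <;> rcases j with j | j <;> fin_cases i <;> fin_cases j <;>
    simp [delta1, deltaDiag, Matrix.diagonal]

lemma deltaConj_iff {N q : ℕ} {k k' : Gamma0 N} : DeltaConj N q k k' ↔
    ∀ i j, (mat k i j : ℚ) * deltaDiag q j = deltaDiag q i * (mat k' i j : ℚ) := by
  rw [DeltaConj, delta1_eq_diagonal, ← Matrix.ext_iff]
  simp [Matrix.mul_diagonal, Matrix.diagonal_mul, toRat]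

lemma delta1_mem {q : ℕ} (hq : q ≠ 0) : delta1 q ∈ Matrix.symplecticGroup (Fin 2) ℚ := by
  have hq' : (q : ℚ) ≠ 0 := by exact_mod_cast hq
  rw [SymplecticGroup.mem_iff]
  simp [delta1, Matrix.J, Matrix.fromBlocks_multiply, Matrix.fromBlocks_transpose]
  constructor <;> ext i j <;> fin_cases i <;> fin_cases j <;>
    simp [Matrix.vecMul, dotProduct, Fin.sum_univ_two, hq']

lemma toRat_mem (γ : Sp2Z) : toRat γ ∈ Matrix.symplecticGroup (Fin 2) ℚ :=
  SymplecticGroup.map_mem γ.2 (Int.castRingHom ℚ)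

lemma mem_of_map_mem {X : Mat4 ℤ}
    (h : X.map (Int.castRingHom ℚ) ∈ Matrix.symplecticGroup (Fin 2) ℚ) :
    X ∈ Matrix.symplecticGroup (Fin 2) ℤ := by
  rw [SymplecticGroup.mem_iff] at h ⊢
  apply Matrix.map_injective (Int.castRingHom ℚ).injective_int
  simp only [Matrix.map_mul, Matrix.map_J]
  exact h

/-- `δ₁` is symplectic over `ℚ`, so its conjugates are too; only integrality and the level condition
need checking. -/
lemma exists_deltaConj_right {N q : ℕ} (hq : q ≠ 0) (k : Gamma0 N) {X : Mat4 ℤ}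
    (hX : ∀ i j, (mat k i j : ℚ) * deltaDiag q j = deltaDiag q i * (X i j : ℚ))
    (hN : ∀ i j, (N : ℤ) ∣ X (.inr i) (.inl j)) : ∃ k', DeltaConj N q k k' := by
  let δ : Matrix.symplecticGroup (Fin 2) ℚ := ⟨delta1 q, delta1_mem hq⟩
  have h : toRat k * delta1 q = delta1 q * X.map (Int.castRingHom ℚ) := by
    rw [delta1_eq_diagonal, ← Matrix.ext_iff]
    simpa [Matrix.mul_diagonal, Matrix.diagonal_mul, toRat] using hX
  have hi : ((δ⁻¹ : Matrix.symplecticGroup (Fin 2) ℚ) : Mat4 ℚ) * delta1 q = 1 :=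
    congrArg Subtype.val (inv_mul_cancel δ)
  have hXm : X ∈ Matrix.symplecticGroup (Fin 2) ℤ := by
    apply mem_of_map_mem
    have := (δ⁻¹ * ⟨toRat k, toRat_mem k⟩ * δ : Matrix.symplecticGroup (Fin 2) ℚ).2
    convert this using 1
    change _ = ((δ⁻¹ : Matrix.symplecticGroup (Fin 2) ℚ) : Mat4 ℚ) * toRat k * delta1 q
    rw [Matrix.mul_assoc, h, ← Matrix.mul_assoc, hi, Matrix.one_mul]
  exact ⟨⟨⟨X, hXm⟩, hN⟩, h⟩

lemma exists_deltaConj_left {N q : ℕ} (hq : q ≠ 0) (k' : Gamma0 N) {X : Mat4 ℤ}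
    (hX : ∀ i j, (X i j : ℚ) * deltaDiag q j = deltaDiag q i * (mat k' i j : ℚ))
    (hN : ∀ i j, (N : ℤ) ∣ X (.inr i) (.inl j)) : ∃ k, DeltaConj N q k k' := by
  let δ : Matrix.symplecticGroup (Fin 2) ℚ := ⟨delta1 q, delta1_mem hq⟩
  have h : X.map (Int.castRingHom ℚ) * delta1 q = delta1 q * toRat k' := by
    rw [delta1_eq_diagonal, ← Matrix.ext_iff]
    simpa [Matrix.mul_diagonal, Matrix.diagonal_mul, toRat] using hX
  have hi : delta1 q * ((δ⁻¹ : Matrix.symplecticGroup (Fin 2) ℚ) : Mat4 ℚ) = 1 :=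
    congrArg Subtype.val (mul_inv_cancel δ)
  have hXm : X ∈ Matrix.symplecticGroup (Fin 2) ℤ := by
    apply mem_of_map_mem
    have := (δ * ⟨toRat k', toRat_mem k'⟩ * δ⁻¹ : Matrix.symplecticGroup (Fin 2) ℚ).2
    convert this using 1
    change _ = delta1 q * toRat k' * ((δ⁻¹ : Matrix.symplecticGroup (Fin 2) ℚ) : Mat4 ℚ)
    rw [← h, Matrix.mul_assoc, hi, Matrix.mul_one]
  exact ⟨⟨⟨X, hXm⟩, hN⟩, h⟩

/-! ### Relations between the entries of a symplectic matrix -/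

lemma sum_mul_sub_col (γ : Sp2Z) (i j : Fin 2) :
    ∑ l, ((γ : Mat4 ℤ) (.inl l) (.inl i) * (γ : Mat4 ℤ) (.inr l) (.inr j) -
      (γ : Mat4 ℤ) (.inr l) (.inl i) * (γ : Mat4 ℤ) (.inl l) (.inr j)) = (1 : Mat2 ℤ) i j := by
  have h := congrFun (congrFun (SymplecticGroup.mem_iff'.1 γ.2) (.inl i)) (.inr j)
  simp [Matrix.mul_apply, Matrix.J, Matrix.one_apply] at h
  simp [Matrix.one_apply]
  split_ifs at h ⊢ <;> linarith

lemma sum_mul_sub_row (γ : Sp2Z) (i j : Fin 2) :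
    ∑ l, ((γ : Mat4 ℤ) (.inl i) (.inl l) * (γ : Mat4 ℤ) (.inr j) (.inr l) -
      (γ : Mat4 ℤ) (.inl i) (.inr l) * (γ : Mat4 ℤ) (.inr j) (.inl l)) = (1 : Mat2 ℤ) i j := by
  have h := congrFun (congrFun (SymplecticGroup.mem_iff.1 γ.2) (.inl i)) (.inr j)
  simp [Matrix.mul_apply, Matrix.J, Matrix.one_apply] at h
  simp [Matrix.one_apply]
  split_ifs at h ⊢ <;> linarith

lemma sum_mul_sub_left (γ : Sp2Z) (i j : Fin 2) :
    ∑ l, ((γ : Mat4 ℤ) (.inl l) (.inl i) * (γ : Mat4 ℤ) (.inr l) (.inl j) -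
      (γ : Mat4 ℤ) (.inr l) (.inl i) * (γ : Mat4 ℤ) (.inl l) (.inl j)) = 0 := by
  have h := congrFun (congrFun (SymplecticGroup.mem_iff'.1 γ.2) (.inl i)) (.inl j)
  simp [Matrix.mul_apply, Matrix.J, Matrix.one_apply] at h ⊢
  linarith

/-- Membership in `δ₁Γ₀(N)δ₁⁻¹` in terms of entries. -/
lemma mem_conjInter_of_dvd {N q : ℕ} (hq : q ≠ 0) (k : Gamma0 N)
    (hA : (q : ℤ) ∣ mat k (.inl 0) (.inl 1)) (hD : (q : ℤ) ∣ mat k (.inr 1) (.inr 0))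
    (hB : (q : ℤ) ^ 2 ∣ mat k (.inl 0) (.inr 0)) (hB1 : (q : ℤ) ∣ mat k (.inl 0) (.inr 1))
    (hB2 : (q : ℤ) ∣ mat k (.inl 1) (.inr 0)) : k ∈ conjInter N (delta1 q) := by
  have hq' : (q : ℚ) ≠ 0 := by exact_mod_cast hq
  obtain ⟨a, ha⟩ := hA
  obtain ⟨d, hd⟩ := hD
  obtain ⟨b, hb⟩ := hB
  obtain ⟨b1, hb1⟩ := hB1
  obtain ⟨b2, hb2⟩ := hB2
  have hC : ∀ i j, (N : ℤ) ∣ mat k (.inr i) (.inl j) := k.2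
  refine mem_conjInter.2 (exists_deltaConj_right hq k (X := Matrix.fromBlocks
    !![mat k (.inl 0) (.inl 0), a; q * mat k (.inl 1) (.inl 0), mat k (.inl 1) (.inl 1)]
    !![b, b1; b2, mat k (.inl 1) (.inr 1)]
    !![q ^ 2 * mat k (.inr 0) (.inl 0), q * mat k (.inr 0) (.inl 1);
      q * mat k (.inr 1) (.inl 0), mat k (.inr 1) (.inl 1)]
    !![mat k (.inr 0) (.inr 0), q * mat k (.inr 0) (.inr 1); d, mat k (.inr 1) (.inr 1)]) ?_ ?_)
  · intro i j
    rcases i with i | i <;> rcases j with j | j <;> fin_cases i <;> fin_cases j <;>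
      simp [deltaDiag, ha, hd, hb, hb1, hb2] <;> field_simp
  · intro i j
    fin_cases i <;> fin_cases j <;> simp
    exacts [(hC 0 0).mul_left _, (hC 0 1).mul_left _, (hC 1 0).mul_left _, hC 1 1]

/-- Membership in `δ₁⁻¹Γ₀(N)δ₁` in terms of the first column. -/
lemma exists_deltaConj_of_dvd {N q : ℕ} (hq : q.Prime) (hqN : q ∣ N) (k : Gamma0 N)
    (hA : (q : ℤ) ∣ mat k (.inl 1) (.inl 0))
    (hC : (N * q ^ 2 : ℤ) ∣ mat k (.inr 0) (.inl 0)) (hC1 : (N * q : ℤ) ∣ mat k (.inr 1) (.inl 0)) :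
    ∃ l, DeltaConj N q l k := by
  have hq' : (q : ℚ) ≠ 0 := by exact_mod_cast hq.ne_zero
  have hqp : Prime (q : ℤ) := Nat.prime_iff_prime_int.1 hq
  have hqN' : (q : ℤ) ∣ N := by exact_mod_cast hqN
  have hCN : ∀ i j, (N : ℤ) ∣ mat k (.inr i) (.inl j) := k.2
  have e00 := sum_mul_sub_col k 0 0
  have e01 := sum_mul_sub_col k 0 1
  have f01 := sum_mul_sub_left k 0 1
  simp only [Fin.sum_univ_two, Matrix.one_apply_eq, Matrix.one_apply_ne zero_ne_one]
    at e00 e01 f01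
  -- Modulo `q` one has `C ≡ 0` and `AᵀD ≡ 1`, so the first column of `A` is nonzero; its lower
  -- entry vanishes by `hA`. The remaining divisibilities come from `AᵀD - CᵀB = 1` and the symmetry
  -- of `AᵀC`.
  have hunit : ¬ (q : ℤ) ∣ mat k (.inl 0) (.inl 0) := by
    intro h
    apply hqp.not_dvd_one
    rw [← e00]
    exact dvd_add (dvd_sub (h.mul_right _) ((hqN'.trans (hCN 0 0)).mul_right _))
      (dvd_sub (hA.mul_right _) ((hqN'.trans (hCN 1 0)).mul_right _))
  have hD : (q : ℤ) ∣ mat k (.inr 0) (.inr 1) := by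
    refine (hqp.dvd_or_dvd (a := mat k (.inl 0) (.inl 0)) ?_).resolve_left hunit
    have h1 := ((hqN'.trans (hCN 0 0)).mul_right (mat k (.inl 0) (.inr 1)))
    have h2 := ((hqN'.trans (hCN 1 0)).mul_right (mat k (.inl 1) (.inr 1)))
    have h3 := hA.mul_right (mat k (.inr 1) (.inr 1))
    have h4 := dvd_sub (dvd_add h1 h2) h3
    convert h4 using 1
    linarith
  obtain ⟨c, hc⟩ := hCN 0 1
  obtain ⟨a, ha⟩ := hA
  obtain ⟨c0, hc0⟩ := hC
  obtain ⟨c1, hc1⟩ := hC1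
  obtain ⟨c2, hc2⟩ := hCN 1 1
  have hcq : ∃ c', mat k (.inr 0) (.inl 1) = N * q * c' := by
    -- The symmetry of `AᵀC` has to be divided by `N` before reducing modulo `q`.
    rcases eq_or_ne (N : ℤ) 0 with hN0 | hN0
    · exact ⟨0, by rw [hc, hN0]; ring⟩
    have h1 : (q : ℤ) ∣ c := by
      refine (hqp.dvd_or_dvd (a := mat k (.inl 0) (.inl 0)) ?_).resolve_left hunit
      refine ⟨q * c0 * mat k (.inl 0) (.inl 1) + c1 * mat k (.inl 1) (.inl 1) - a * c2, ?_⟩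
      apply mul_left_cancel₀ hN0
      simp only [mat] at *
      rw [ha, hc, hc0, hc1, hc2] at f01
      linear_combination f01
    obtain ⟨c', rfl⟩ := h1
    exact ⟨c', by rw [hc]; ring⟩
  obtain ⟨c', hc'⟩ := hcq
  obtain ⟨d, hd⟩ := hD
  refine exists_deltaConj_left hq.ne_zero k (X := Matrix.fromBlocks
    !![mat k (.inl 0) (.inl 0), q * mat k (.inl 0) (.inl 1); a, mat k (.inl 1) (.inl 1)]
    !![q ^ 2 * mat k (.inl 0) (.inr 0), q * mat k (.inl 0) (.inr 1);
      q * mat k (.inl 1) (.inr 0), mat k (.inl 1) (.inr 1)]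
    !![N * c0, N * c'; N * c1, mat k (.inr 1) (.inl 1)]
    !![mat k (.inr 0) (.inr 0), d; q * mat k (.inr 1) (.inr 0), mat k (.inr 1) (.inr 1)]) ?_ ?_
  · intro i j
    rcases i with i | i <;> rcases j with j | j <;> fin_cases i <;> fin_cases j <;>
      simp [deltaDiag, ha, hd, hc0, hc', hc1] <;> field_simp
  · intro i j
    fin_cases i <;> fin_cases j <;> simp
    exact hCN 1 1

/-- The two `D` blocks are conjugate by `diag(q⁻¹, 1)`. -/
lemma DeltaConj.det_blockD_eq {N q : ℕ} (hq : q ≠ 0) {k k' : Gamma0 N} (h : DeltaConj N q k k') :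
    (blockD k').det = (blockD k).det := by
  have hq' : (q : ℚ) ≠ 0 := by exact_mod_cast hq
  rw [deltaConj_iff] at h
  have h00 := h (.inr 0) (.inr 0)
  have h01 := h (.inr 0) (.inr 1)
  have h10 := h (.inr 1) (.inr 0)
  have h11 := h (.inr 1) (.inr 1)
  simp only [deltaDiag, Sum.elim_inr, Matrix.cons_val_zero, Matrix.cons_val_one,
    Matrix.cons_val_fin_one, mul_one, one_mul] at h00 h01 h10 h11
  rw [mul_comm] at h00
  have h00 := mul_left_cancel₀ (inv_ne_zero hq') h00
  rw [Matrix.det_fin_two, Matrix.det_fin_two]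
  simp only [blockD, Matrix.toBlocks₂₂, Matrix.of_apply]
  have : ((mat k' (.inr 0) (.inr 0) * mat k' (.inr 1) (.inr 1) -
      mat k' (.inr 0) (.inr 1) * mat k' (.inr 1) (.inr 0) : ℤ) : ℚ) =
      ((mat k (.inr 0) (.inr 0) * mat k (.inr 1) (.inr 1) -
      mat k (.inr 0) (.inr 1) * mat k (.inr 1) (.inr 0) : ℤ) : ℚ) := by
    push_cast
    rw [← h00, ← h11, ← h10, h01]
    ring
  exact_mod_cast this

end SiegelEis

/-! ### The stabilizer of a cusp -/

namespace SiegelEis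

lemma natCast_dvd_of_squarefree {n : ℕ} (hn : Squarefree n) {a : ℤ}
    (h : ∀ p : ℕ, p.Prime → p ∣ n → (p : ℤ) ∣ a) : (n : ℤ) ∣ a := by
  rw [Int.natCast_dvd, ← Nat.prod_primeFactors_of_squarefree hn]
  refine Finset.prod_primes_dvd _ (fun p hp => (Nat.prime_of_mem_primeFactors hp).prime)
    fun p hp => ?_
  exact Int.natCast_dvd.1 (h p (Nat.prime_of_mem_primeFactors hp) (Nat.dvd_of_mem_primeFactors hp))

/-- `M` is a diagonal integral matrix with `M ≡ 0` modulo `N₀`, `M ≡ diag(1, 0)` modulo `N₁` and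
`M ≡ I` modulo `N₂`. -/
structure IsCuspDiag (N₀ N₁ N₂ : ℕ) (M : Mat2 ℤ) : Prop where
  isDiag : M.IsDiag
  zero : ∀ i, (N₀ : ℤ) ∣ M i i
  one : (N₁ : ℤ) ∣ M 0 0 - 1
  one' : (N₁ : ℤ) ∣ M 1 1
  two : ∀ i, (N₂ : ℤ) ∣ M i i - 1

lemma IsCuspMatrix.isCuspDiag {N₀ N₁ N₂ : ℕ} {M : Mat2 ℤ} (hM : IsCuspMatrix N₀ N₁ N₂ M)
    (hN : Squarefree (N₀ * N₁ * N₂)) : IsCuspDiag N₀ N₁ N₂ M where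
  isDiag := hM.isDiag
  zero i := natCast_dvd_of_squarefree (hN.of_mul_left.of_mul_left) fun p hp hpN => by
    have := hM.mod_zero p hp hpN
    rcases Fin.exists_fin_two.1 ⟨i, rfl⟩ with rfl | rfl
    exacts [Int.modEq_zero_iff_dvd.1 this.1, Int.modEq_zero_iff_dvd.1 this.2]
  one := natCast_dvd_of_squarefree (hN.of_mul_left.of_mul_right) fun p hp hpN =>
    (hM.mod_one p hp hpN).1.symm.dvd
  one' := natCast_dvd_of_squarefree (hN.of_mul_left.of_mul_right) fun p hp hpN =>
    Int.modEq_zero_iff_dvd.1 (hM.mod_one p hp hpN).2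
  two i := natCast_dvd_of_squarefree hN.of_mul_right fun p hp hpN => by
    have := hM.mod_two p hp hpN
    rcases Fin.exists_fin_two.1 ⟨i, rfl⟩ with rfl | rfl
    exacts [this.1.symm.dvd, this.2.symm.dvd]

lemma pairRow_mul (M : Mat2 ℤ) (x y : Sp2Z) : pairRow M (x * y) = pairRow M x * (y : Mat4 ℤ) := by
  simp only [pairRow, Submonoid.coe_mul, Matrix.mul_assoc]

lemma pairRow_one (M : Mat2 ℤ) : pairRow M 1 = cuspRow M := by
  simp [pairRow]

/-- The stabilizer in `Γ₀(N)` of the `SL₂(ℤ)`-class of `(M I)`. -/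
def cuspStab (N : ℕ) (M : Mat2 ℤ) : Subgroup (Gamma0 N) where
  carrier := {h | ∃ G : SL(2, ℤ), pairRow M h = (G : Mat2 ℤ) * cuspRow M}
  one_mem' := ⟨1, by simp [pairRow_one]⟩
  mul_mem' := by
    rintro a b ⟨G, hG⟩ ⟨G', hG'⟩
    refine ⟨G * G', ?_⟩
    rw [Subgroup.coe_mul, pairRow_mul, hG, Matrix.SpecialLinearGroup.coe_mul, Matrix.mul_assoc,
      Matrix.mul_assoc, ← hG', pairRow]
  inv_mem' := by
    rintro a ⟨G, hG⟩
    refine ⟨G⁻¹, ?_⟩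
    have h1 : ((G⁻¹ : SL(2, ℤ)) : Mat2 ℤ) * (G : Mat2 ℤ) = 1 := by
      rw [← Matrix.SpecialLinearGroup.coe_mul]; simp
    have h2 : pairRow M (a * a⁻¹ : Gamma0 N) = cuspRow M := by
      rw [mul_inv_cancel, Subgroup.coe_one, pairRow_one]
    rw [Subgroup.coe_mul, pairRow_mul, hG] at h2
    rw [← h2, ← Matrix.mul_assoc, ← Matrix.mul_assoc, h1, Matrix.one_mul]
    rfl

lemma mem_cuspStab {N : ℕ} {M : Mat2 ℤ} {h : Gamma0 N} :
    h ∈ cuspStab N M ↔ ∃ G : SL(2, ℤ), pairRow M h = (G : Mat2 ℤ) * cuspRow M := Iff.rfl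

/-- This turns the Eisenstein series into a sum over right cosets of a subgroup. -/
lemma pairSetoid_iff_mem_cuspStab {N : ℕ} {M : Mat2 ℤ} (x y : Gamma0 N) :
    pairSetoid N M x y ↔ y * x⁻¹ ∈ cuspStab N M := by
  rw [pairSetoid_iff, mem_cuspStab]
  refine exists_congr fun G => ⟨fun h => ?_, fun h => ?_⟩
  · rw [Subgroup.coe_mul, pairRow_mul, h, Matrix.mul_assoc, ← pairRow_mul, Subgroup.coe_inv,
      mul_inv_cancel, pairRow_one]
  · have : (y : Sp2Z) = ((y * x⁻¹ : Gamma0 N) : Sp2Z) * x := by simp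
    rw [this, pairRow_mul, h, Matrix.mul_assoc, pairRow]

lemma pairRow_apply {M : Mat2 ℤ} (hM : M.IsDiag) (γ : Sp2Z) (i : Fin 2) (j : Fin 2 ⊕ Fin 2) :
    pairRow M γ i j = M i i * (γ : Mat4 ℤ) (.inl i) j + (γ : Mat4 ℤ) (.inr i) j := by
  simp only [pairRow, cuspRow, Matrix.mul_apply, Fintype.sum_sum_type, Fin.sum_univ_two,
    Matrix.fromCols_apply_inl, Matrix.fromCols_apply_inr]
  rcases Fin.exists_fin_two.1 ⟨i, rfl⟩ with rfl | rfl <;>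
    simp [hM zero_ne_one, hM one_ne_zero]

lemma mul_cuspRow_inl {M : Mat2 ℤ} (hM : M.IsDiag) (G : Mat2 ℤ) (i j : Fin 2) :
    (G * cuspRow M) i (.inl j) = G i j * M j j := by
  simp only [cuspRow, Matrix.mul_apply, Fin.sum_univ_two, Matrix.fromCols_apply_inl]
  rcases Fin.exists_fin_two.1 ⟨j, rfl⟩ with rfl | rfl <;>
    simp [hM zero_ne_one, hM one_ne_zero]

lemma mul_cuspRow_inr (M G : Mat2 ℤ) (i j : Fin 2) : (G * cuspRow M) i (.inr j) = G i j := by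
  rw [cuspRow, Matrix.mul_fromCols, Matrix.fromCols_apply_inr, Matrix.mul_one]

lemma pairRow_eq_iff {M : Mat2 ℤ} (hM : M.IsDiag) {γ : Sp2Z} {G : Mat2 ℤ} :
    pairRow M γ = G * cuspRow M ↔
      (∀ i j, M i i * (γ : Mat4 ℤ) (.inl i) (.inl j) + (γ : Mat4 ℤ) (.inr i) (.inl j) =
        G i j * M j j) ∧
      ∀ i j, M i i * (γ : Mat4 ℤ) (.inl i) (.inr j) + (γ : Mat4 ℤ) (.inr i) (.inr j) = G i j := by
  simp only [← Matrix.ext_iff, Sum.forall, pairRow_apply hM, mul_cuspRow_inl hM, mul_cuspRow_inr]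
  exact ⟨fun h => ⟨fun i => (h i).1, fun i => (h i).2⟩, fun h i => ⟨h.1 i, h.2 i⟩⟩

/-! ### The character of `det D` -/

lemma det_blockD (γ : Sp2Z) : (blockD γ).det =
    (γ : Mat4 ℤ) (.inr 0) (.inr 0) * (γ : Mat4 ℤ) (.inr 1) (.inr 1) -
      (γ : Mat4 ℤ) (.inr 0) (.inr 1) * (γ : Mat4 ℤ) (.inr 1) (.inr 0) := by
  rw [Matrix.det_fin_two]
  rfl

lemma cast_det_blockD_mul {N : ℕ} (x y : Gamma0 N) :
    ((blockD (x * y : Gamma0 N)).det : ZMod N) = (blockD x).det * (blockD y).det := by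
  have hx : ∀ i j, ((mat x (.inr i) (.inl j) : ℤ) : ZMod N) = 0 := fun i j =>
    (ZMod.intCast_zmod_eq_zero_iff_dvd _ _).2 (x.2 i j)
  have h : ∀ i j, ((mat (x * y) (.inr i) (.inr j) : ℤ) : ZMod N) =
      (mat x (.inr i) (.inr 0) : ZMod N) * (mat y (.inr 0) (.inr j) : ZMod N) +
      (mat x (.inr i) (.inr 1) : ZMod N) * (mat y (.inr 1) (.inr j) : ZMod N) := by
    intro i j
    have : mat (x * y) = mat x * mat y := rfl
    rw [this, Matrix.mul_apply]
    simp only [Fintype.sum_sum_type, Fin.sum_univ_two]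
    push_cast
    rw [hx, hx]
    ring
  have hd : ∀ z : Gamma0 N, ((blockD z).det : ZMod N) =
      (mat z (.inr 0) (.inr 0) : ZMod N) * (mat z (.inr 1) (.inr 1) : ZMod N) -
        (mat z (.inr 0) (.inr 1) : ZMod N) * (mat z (.inr 1) (.inr 0) : ZMod N) := fun z => by
    rw [det_blockD, Int.cast_sub, Int.cast_mul, Int.cast_mul]
  rw [hd, hd, hd, h, h, h, h]
  ring

/-- `A Dᵀ ≡ 1` modulo every divisor of the level. -/
lemma cast_sum_mul_row {N n : ℕ} (hn : n ∣ N) (γ : Gamma0 N) (i j : Fin 2) :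
    (mat γ (.inl i) (.inl 0) : ZMod n) * mat γ (.inr j) (.inr 0) +
      (mat γ (.inl i) (.inl 1) : ZMod n) * mat γ (.inr j) (.inr 1) = (1 : Mat2 (ZMod n)) i j := by
  have h := congrArg (Int.cast : ℤ → ZMod n) (sum_mul_sub_row γ i j)
  have hC : ∀ i j, ((mat γ (.inr i) (.inl j) : ℤ) : ZMod n) = 0 := fun i j =>
    (ZMod.intCast_zmod_eq_zero_iff_dvd _ _).2 ((Int.natCast_dvd_natCast.2 hn).trans (γ.2 i j))
  simp only [mat] at hC ⊢
  simp only [Fin.sum_univ_two] at h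
  push_cast at h
  rw [hC, hC] at h
  rw [show (1 : Mat2 (ZMod n)) i j = (((1 : Mat2 ℤ) i j : ℤ) : ZMod n) by
    simp only [Matrix.one_apply]; split_ifs <;> simp, ← h]
  ring

/-- Let `(M I)h = G(M I)`. Modulo `N₀`, `D ≡ G` has determinant 1. Modulo `N₂`, `A ≡ G` and `ADᵀ ≡
1`, so again `det D ≡ 1`. Modulo `N₁`, `G` is upper triangular and `det D ≡ G₁₁²` with `G₁₁` a unit;
this is where `χ₁² = 1` enters. -/
lemma char_det_blockD_of_mem_cuspStab {N₀ N₁ N₂ : ℕ} {χ : DirichletCharacter ℂ (N₀ * N₁ * N₂)}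
    {χ₀ : DirichletCharacter ℂ N₀} {χ₁ : DirichletCharacter ℂ N₁} {χ₂ : DirichletCharacter ℂ N₂}
    (hχ : ∀ a : ℤ, χ (a : ZMod (N₀ * N₁ * N₂)) =
      χ₀ (a : ZMod N₀) * χ₁ (a : ZMod N₁) * χ₂ (a : ZMod N₂))
    (hχ₁ : χ₁ ^ 2 = 1) {M : Mat2 ℤ} (hM : IsCuspDiag N₀ N₁ N₂ M)
    {h : Gamma0 (N₀ * N₁ * N₂)} (hh : h ∈ cuspStab (N₀ * N₁ * N₂) M) :
    χ ((blockD h).det : ZMod (N₀ * N₁ * N₂)) = 1 := by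
  obtain ⟨G, hG⟩ := hh
  obtain ⟨hl, hr⟩ := (pairRow_eq_iff hM.isDiag).1 hG
  have hdet : (G : Mat2 ℤ) 0 0 * (G : Mat2 ℤ) 1 1 - (G : Mat2 ℤ) 0 1 * (G : Mat2 ℤ) 1 0 = 1 := by
    rw [← Matrix.det_fin_two]; exact G.2
  have hC : ∀ {n : ℕ}, n ∣ N₀ * N₁ * N₂ → ∀ i j, ((mat h (.inr i) (.inl j) : ℤ) : ZMod n) = 0 :=
    fun hn i j => (ZMod.intCast_zmod_eq_zero_iff_dvd _ _).2
      ((Int.natCast_dvd_natCast.2 hn).trans (h.2 i j))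
  have d0 : N₀ ∣ N₀ * N₁ * N₂ := ⟨N₁ * N₂, by ring⟩
  have d1 : N₁ ∣ N₀ * N₁ * N₂ := ⟨N₀ * N₂, by ring⟩
  have d2 : N₂ ∣ N₀ * N₁ * N₂ := ⟨N₀ * N₁, by ring⟩
  have hL : ∀ (n : ℕ) i j, (M i i : ZMod n) * (mat h (.inl i) (.inl j) : ZMod n) +
      mat h (.inr i) (.inl j) = (G : Mat2 ℤ) i j * (M j j : ZMod n) := fun n i j => by
    exact_mod_cast congrArg (Int.cast : ℤ → ZMod n) (hl i j)
  have hR : ∀ (n : ℕ) i j, (M i i : ZMod n) * (mat h (.inl i) (.inr j) : ZMod n) +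
      mat h (.inr i) (.inr j) = (G : Mat2 ℤ) i j := fun n i j => by
    exact_mod_cast congrArg (Int.cast : ℤ → ZMod n) (hr i j)
  have hdetn : ∀ n : ℕ, ((G : Mat2 ℤ) 0 0 : ZMod n) * (G : Mat2 ℤ) 1 1 -
      (G : Mat2 ℤ) 0 1 * (G : Mat2 ℤ) 1 0 = 1 := fun n => by
    exact_mod_cast congrArg (Int.cast : ℤ → ZMod n) hdet
  have e0 : ((blockD h).det : ZMod N₀) = 1 := by
    have m : ∀ i, (M i i : ZMod N₀) = 0 := fun i =>
      (ZMod.intCast_zmod_eq_zero_iff_dvd _ _).2 (hM.zero i)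
    have r := hR N₀
    simp only [m, zero_mul, zero_add] at r
    rw [det_blockD]
    push_cast
    rw [r, r, r, r, hdetn]
  have e2 : ((blockD h).det : ZMod N₂) = 1 := by
    have m : ∀ i, (M i i : ZMod N₂) = 1 := fun i => by
      have := (ZMod.intCast_zmod_eq_zero_iff_dvd _ _).2 (hM.two i)
      push_cast at this
      exact sub_eq_zero.1 this
    have l := hL N₂
    simp only [m, one_mul, mul_one, hC d2, add_zero] at l
    have r := cast_sum_mul_row d2 h
    simp only [l] at r
    have r00 := r 0 0
    have r01 := r 0 1
    have r10 := r 1 0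
    have r11 := r 1 1
    simp only [Matrix.one_apply_eq, Matrix.one_apply_ne one_ne_zero,
      Matrix.one_apply_ne zero_ne_one] at r00 r01 r10 r11
    have hd := hdetn N₂
    rw [det_blockD]
    push_cast
    simp only [mat] at *
    generalize (((G : Mat2 ℤ) 0 0 : ℤ) : ZMod N₂) = g00 at *
    generalize (((G : Mat2 ℤ) 0 1 : ℤ) : ZMod N₂) = g01 at *
    generalize (((G : Mat2 ℤ) 1 0 : ℤ) : ZMod N₂) = g10 at *
    generalize (((G : Mat2 ℤ) 1 1 : ℤ) : ZMod N₂) = g11 at *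
    generalize (((h : Sp2Z) : Mat4 ℤ) (.inr 0) (.inr 0) : ZMod N₂) = x00 at *
    generalize (((h : Sp2Z) : Mat4 ℤ) (.inr 0) (.inr 1) : ZMod N₂) = x01 at *
    generalize (((h : Sp2Z) : Mat4 ℤ) (.inr 1) (.inr 0) : ZMod N₂) = x10 at *
    generalize (((h : Sp2Z) : Mat4 ℤ) (.inr 1) (.inr 1) : ZMod N₂) = x11 at *
    linear_combination (-(x00 * x11 - x01 * x10)) * hd + (g10 * x10 + g11 * x11) * r00 + r11 -
      (g10 * x00 + g11 * x01) * r01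
  have e1 : ((blockD h).det : ZMod N₁) = ((G : Mat2 ℤ) 1 1 : ZMod N₁) ^ 2 ∧
      ((G : Mat2 ℤ) 0 0 : ZMod N₁) * (G : Mat2 ℤ) 1 1 = 1 := by
    have m0 : (M 0 0 : ZMod N₁) = 1 := by
      have := (ZMod.intCast_zmod_eq_zero_iff_dvd _ _).2 hM.one
      push_cast at this
      exact sub_eq_zero.1 this
    have m1 : (M 1 1 : ZMod N₁) = 0 := (ZMod.intCast_zmod_eq_zero_iff_dvd _ _).2 hM.one'
    have l00 := hL N₁ 0 0
    have l01 := hL N₁ 0 1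
    have l10 := hL N₁ 1 0
    have r10 := hR N₁ 1 0
    have r11 := hR N₁ 1 1
    simp only [m0, m1, one_mul, mul_one, zero_mul, mul_zero, zero_add, add_zero, hC d1]
      at l00 l01 l10 r10 r11
    have r := cast_sum_mul_row d1 h 0 0
    simp only [l00, l01, Matrix.one_apply_eq, zero_mul, add_zero] at r
    have hd := hdetn N₁
    rw [← l10, mul_zero, sub_zero] at hd
    rw [← l10] at r10
    refine ⟨?_, hd⟩
    rw [det_blockD]
    push_cast
    rw [r10, r11, mul_zero, sub_zero]
    linear_combination ((G : Mat2 ℤ) 1 1 : ZMod N₁) ^ 2 * r -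
      (mat h (.inr 0) (.inr 0) : ZMod N₁) * ((G : Mat2 ℤ) 1 1 : ZMod N₁) * hd
  have hu : IsUnit ((G : Mat2 ℤ) 1 1 : ZMod N₁) := IsUnit.of_mul_eq_one_right _ e1.2
  rw [hχ, e0, e2, e1.1, map_one, map_one, one_mul, mul_one, map_pow,
    ← MulChar.pow_apply' _ two_ne_zero, hχ₁, MulChar.one_apply hu]

lemma eisTerm_mul_left {N₀ N₁ N₂ : ℕ} (k : ℕ) {χ : DirichletCharacter ℂ (N₀ * N₁ * N₂)}
    {χ₀ : DirichletCharacter ℂ N₀} {χ₁ : DirichletCharacter ℂ N₁} {χ₂ : DirichletCharacter ℂ N₂}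
    (hχ : ∀ a : ℤ, χ (a : ZMod (N₀ * N₁ * N₂)) =
      χ₀ (a : ZMod N₀) * χ₁ (a : ZMod N₁) * χ₂ (a : ZMod N₂))
    (hχ₁ : χ₁ ^ 2 = 1) {M : Mat2 ℤ} (hM : IsCuspDiag N₀ N₁ N₂ M)
    {h : Gamma0 (N₀ * N₁ * N₂)} (hh : h ∈ cuspStab (N₀ * N₁ * N₂) M)
    (γ : Gamma0 (N₀ * N₁ * N₂)) (τ : Mat2 ℂ) :
    eisTerm (N₀ * N₁ * N₂) k χ M (h * γ : Gamma0 (N₀ * N₁ * N₂)) τ =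
      eisTerm (N₀ * N₁ * N₂) k χ M γ τ := by
  have hd := char_det_blockD_of_mem_cuspStab hχ hχ₁ hM hh
  obtain ⟨G, hG⟩ := hh
  rw [eisTerm_eq, eisTerm_eq, cast_det_blockD_mul, map_mul, hd, one_mul]
  have h1 : pairRow M (h * γ : Gamma0 (N₀ * N₁ * N₂)) = (G : Mat2 ℤ) * pairRow M γ := by
    rw [Subgroup.coe_mul, pairRow_mul, hG, Matrix.mul_assoc, pairRow]
  have h2 : ((G : Mat2 ℤ).map (Int.castRingHom ℂ)).det = 1 := by
    rw [← RingHom.mapMatrix_apply, ← RingHom.map_det, G.2, map_one]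
  have h3 : autFactor ((pairRow M (h * γ : Gamma0 (N₀ * N₁ * N₂))).map (Int.castRingHom ℂ)) τ =
      (G : Mat2 ℤ).map (Int.castRingHom ℂ) *
        autFactor ((pairRow M γ).map (Int.castRingHom ℂ)) τ := by
    rw [h1, Matrix.map_mul, autFactor, autFactor]
    exact Matrix.mul_assoc _ _ _
  rw [h3, Matrix.det_mul, h2, one_mul]

end SiegelEis

/-! ### Elements of the stabilizer, and its action on cosets -/

namespace SiegelEis

lemma exists_dvd_sub_mul {a n : ℤ} (h : IsCoprime a n) (c : ℤ) : ∃ x, n ∣ c - a * x := by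
  obtain ⟨u, v, huv⟩ := h
  exact ⟨c * u, c * v, by linear_combination (-c) * huv⟩

lemma pairRow_mul_of_pairRow_eq {M : Mat2 ℤ} {x y : Sp2Z} {G : Mat2 ℤ}
    (hx : pairRow M x = G * cuspRow M) : pairRow M (x * y) = G * pairRow M y := by
  rw [pairRow_mul, hx, Matrix.mul_assoc, pairRow]

lemma pairRow_mul_inv {M : Mat2 ℤ} {x y : Sp2Z} {G G' : Mat2 ℤ}
    (hx : pairRow M x = G * cuspRow M) (hy : pairRow M y = G' * cuspRow M) (hG' : G'.det = 1) :
    pairRow M (x * y⁻¹) = (G * G'.adjugate) * cuspRow M := by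
  have h1 : pairRow M (y⁻¹) = G'.adjugate * cuspRow M := by
    have h2 : G' * pairRow M y⁻¹ = cuspRow M := by
      rw [← pairRow_mul_of_pairRow_eq hy, mul_inv_cancel, pairRow_one]
    rw [← h2, ← Matrix.mul_assoc, Matrix.adjugate_mul, hG', one_smul, Matrix.one_mul]
  rw [pairRow_mul_of_pairRow_eq hx, h1, Matrix.mul_assoc]

/-! ### Explicit elements of the stabilizer -/

lemma exists_coe_eq_fromBlocks {N : ℕ} {A B C D : Mat2 ℤ}
    (h : Matrix.fromBlocks A B C D ∈ Matrix.symplecticGroup (Fin 2) ℤ)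
    (hC : ∀ i j, (N : ℤ) ∣ C i j) :
    ∃ g : Gamma0 N, ((g : Sp2Z) : Mat4 ℤ) = Matrix.fromBlocks A B C D :=
  ⟨⟨⟨_, h⟩, hC⟩, rfl⟩

/-- The matrix is found by solving `(M I)h = G(M I)` with `B = (0 r; r 0)`, which forces `D = G -
MB`. In the applications `r` is a multiple of `N / q`, and `M ≡ I` modulo `q` supplies the
hypothesis. -/
lemma exists_pairRow_eq_upper {N : ℕ} {M : Mat2 ℤ} (hM : M.IsDiag) {r : ℤ}
    (hr : (N : ℤ) ∣ r * (M 0 0 - 1)) :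
    ∃ h : Gamma0 N, pairRow M h = !![1, r; 0, 1] * cuspRow M := by
  have hX : Matrix.fromBlocks !![1, r * M 1 1; r * (M 0 0 - 1), 1] !![0, r; r, 0]
      !![0, r * M 1 1 * (1 - M 0 0); r * M 1 1 * (1 - M 0 0), 0]
      !![1, r * (1 - M 0 0); -(M 1 1 * r), 1] ∈ Matrix.symplecticGroup (Fin 2) ℤ := by
    rw [SymplecticGroup.fromBlocks_mem_iff]
    refine ⟨?_, ?_, ?_⟩ <;> ext i j <;> fin_cases i <;> fin_cases j <;>
      simp [Matrix.mul_apply, Fin.sum_univ_two] <;> ring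
  have hd : (N : ℤ) ∣ r * M 1 1 * (1 - M 0 0) := by
    rw [show r * M 1 1 * (1 - M 0 0) = r * (M 0 0 - 1) * -M 1 1 by ring]
    exact hr.mul_right _
  obtain ⟨g, hg⟩ := exists_coe_eq_fromBlocks (N := N) hX
    (fun i j => by fin_cases i <;> fin_cases j <;> simp [hd])
  refine ⟨g, ?_⟩
  rw [pairRow_eq_iff hM, hg]
  constructor <;> intro i j <;> fin_cases i <;> fin_cases j <;> simp <;> ring

lemma exists_pairRow_eq_lower {N : ℕ} {M : Mat2 ℤ} (hM : M.IsDiag) {r : ℤ}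
    (hr : (N : ℤ) ∣ r * (M 1 1 - 1)) :
    ∃ h : Gamma0 N, pairRow M h = !![1, 0; r, 1] * cuspRow M := by
  have hX : Matrix.fromBlocks !![1, r * (M 1 1 - 1); r * M 0 0, 1] !![0, r; r, 0]
      !![0, r * M 0 0 * (1 - M 1 1); r * M 0 0 * (1 - M 1 1), 0]
      !![1, -(M 0 0 * r); r * (1 - M 1 1), 1] ∈ Matrix.symplecticGroup (Fin 2) ℤ := by
    rw [SymplecticGroup.fromBlocks_mem_iff]
    refine ⟨?_, ?_, ?_⟩ <;> ext i j <;> fin_cases i <;> fin_cases j <;>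
      simp [Matrix.mul_apply, Fin.sum_univ_two] <;> ring
  have hd : (N : ℤ) ∣ r * M 0 0 * (1 - M 1 1) := by
    rw [show r * M 0 0 * (1 - M 1 1) = r * (M 1 1 - 1) * -M 0 0 by ring]
    exact hr.mul_right _
  obtain ⟨g, hg⟩ := exists_coe_eq_fromBlocks (N := N) hX
    (fun i j => by fin_cases i <;> fin_cases j <;> simp [hd])
  refine ⟨g, ?_⟩
  rw [pairRow_eq_iff hM, hg]
  constructor <;> intro i j <;> fin_cases i <;> fin_cases j <;> simp <;> ring

/-- The translation by `NS`, `S = (x y; y 0)`, conjugated by `(I 0; M I)`. It fixes the pair `(M I)`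
itself while shifting the upper half of a matrix by `NS` times its pair. -/
lemma exists_pairRow_eq_one {N : ℕ} {M : Mat2 ℤ} (hM : M.IsDiag) (x y : ℤ) :
    ∃ h : Gamma0 N, pairRow M h = (1 : Mat2 ℤ) * cuspRow M ∧
      ∀ i j, mat h (.inl i) j = (1 : Mat4 ℤ) (.inl i) j +
        N * (!![x, y; y, 0] * cuspRow M) i j := by
  have hX : Matrix.fromBlocks !![1 + N * x * M 0 0, N * y * M 1 1; N * y * M 0 0, 1]
      !![N * x, N * y; N * y, 0]
      !![-(N * x * M 0 0 ^ 2), -(N * y * M 0 0 * M 1 1); -(N * y * M 0 0 * M 1 1), 0]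
      !![1 - N * x * M 0 0, -(N * y * M 0 0); -(N * y * M 1 1), 1] ∈
        Matrix.symplecticGroup (Fin 2) ℤ := by
    rw [SymplecticGroup.fromBlocks_mem_iff]
    refine ⟨?_, ?_, ?_⟩ <;> ext i j <;> fin_cases i <;> fin_cases j <;>
      simp [Matrix.mul_apply, Fin.sum_univ_two] <;> ring
  obtain ⟨g, hg⟩ := exists_coe_eq_fromBlocks (N := N) hX
    (fun i j => by fin_cases i <;> fin_cases j <;> simp [mul_assoc])
  refine ⟨g, ?_, ?_⟩
  · rw [pairRow_eq_iff hM, hg]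
    constructor <;> intro i j <;> fin_cases i <;> fin_cases j <;> simp <;> ring
  · intro i j
    rw [mat, hg]
    rcases j with j | j
    · rw [mul_cuspRow_inl hM]
      fin_cases i <;> fin_cases j <;> simp <;> ring
    · rw [mul_cuspRow_inr]
      fin_cases i <;> fin_cases j <;> simp

section

variable {N₀ N₁ N₂ q : ℕ} {M : Mat2 ℤ}

lemma IsCuspDiag.prime_dvd (hM : IsCuspDiag N₀ N₁ N₂ M) (hqN : q ∣ N₂) (i : Fin 2) :
    (q : ℤ) ∣ M i i - 1 := (Int.natCast_dvd_natCast.2 hqN).trans (hM.two i)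

/-- The cofactor of a prime in the level. -/
lemma exists_level_eq (hN : Squarefree (N₀ * N₁ * N₂)) (hq : q.Prime) (hqN : q ∣ N₂) :
    ∃ r : ℤ, ((N₀ * N₁ * N₂ : ℕ) : ℤ) = r * q ∧ ¬ (q : ℤ) ∣ r := by
  obtain ⟨s, rfl⟩ := hqN
  refine ⟨(N₀ * N₁ * s : ℕ), by push_cast; ring, fun h => ?_⟩
  obtain ⟨t, ht⟩ := Int.natCast_dvd_natCast.1 h
  have : q * q ∣ N₀ * N₁ * (q * s) := ⟨t, by rw [mul_left_comm, ht]; ring⟩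
  exact hq.one_lt.ne' (Nat.isUnit_iff.1 (hN q this))

lemma mem_cuspStab_of_pairRow_eq {N : ℕ} {h : Gamma0 N} {G : Mat2 ℤ}
    (hG : pairRow M h = G * cuspRow M) (hdet : G.det = 1) : h ∈ cuspStab N M :=
  ⟨⟨G, hdet⟩, hG⟩

/-- Modulo `q`, left multiplication by an element of the stabilizer acts on the upper left block
through `SL₂`. -/
lemma cast_mat_mul_inl (hM : IsCuspDiag N₀ N₁ N₂ M) (hqN : q ∣ N₂)
    {h : Gamma0 (N₀ * N₁ * N₂)} {G : Mat2 ℤ} (hG : pairRow M h = G * cuspRow M)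
    (γ : Gamma0 (N₀ * N₁ * N₂)) (i j : Fin 2) :
    (mat (h * γ) (.inl i) (.inl j) : ZMod q) =
      G i 0 * (mat γ (.inl 0) (.inl j) : ZMod q) + G i 1 * (mat γ (.inl 1) (.inl j) : ZMod q) := by
  have h1 := congrFun (congrFun (pairRow_mul_of_pairRow_eq (y := (γ : Sp2Z)) hG) i) (.inl j)
  have hm : ∀ i, (M i i : ZMod q) = 1 := fun i => by
    have := (ZMod.intCast_zmod_eq_zero_iff_dvd _ _).2 (hM.prime_dvd hqN i)
    push_cast at this
    exact sub_eq_zero.1 this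
  have hC : ∀ (γ : Gamma0 (N₀ * N₁ * N₂)) i j, ((mat γ (.inr i) (.inl j) : ℤ) : ZMod q) = 0 :=
    fun γ i j => (ZMod.intCast_zmod_eq_zero_iff_dvd _ _).2
      ((Int.natCast_dvd_natCast.2 (hqN.trans ⟨N₀ * N₁, by ring⟩)).trans (γ.2 i j))
  rw [← Subgroup.coe_mul, Matrix.mul_apply, Fin.sum_univ_two, pairRow_apply hM.isDiag,
    pairRow_apply hM.isDiag, pairRow_apply hM.isDiag] at h1
  have h2 := congrArg (Int.cast : ℤ → ZMod q) h1
  rw [Int.cast_add, Int.cast_add, Int.cast_mul, Int.cast_mul, Int.cast_mul, Int.cast_add,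
    Int.cast_add, Int.cast_mul, Int.cast_mul, hC, hC, hC, hm, hm, hm] at h2
  linear_combination h2

/-- Gaussian elimination on the first column of `A` modulo `q`: a lower unipotent clears the lower
entry, after an upper unipotent has made the upper entry nonzero if necessary. The multiplier `r = N
/ q` keeps the elements in `Γ₀(N)` and is a unit modulo `q`. -/
lemma exists_mem_cuspStab_dvd_inl (hN : Squarefree (N₀ * N₁ * N₂))
    (hM : IsCuspDiag N₀ N₁ N₂ M) (hq : q.Prime) (hqN : q ∣ N₂) (γ : Gamma0 (N₀ * N₁ * N₂)) :
    ∃ h ∈ cuspStab (N₀ * N₁ * N₂) M, (q : ℤ) ∣ mat (h * γ) (.inl 1) (.inl 0) := by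
  have : Fact q.Prime := ⟨hq⟩
  obtain ⟨r, hr, hqr⟩ := exists_level_eq hN hq hqN
  have hr' : (r : ZMod q) ≠ 0 := fun h => hqr ((ZMod.intCast_zmod_eq_zero_iff_dvd _ _).1 h)
  -- the case of a nonzero upper left entry
  have main : ∀ γ : Gamma0 (N₀ * N₁ * N₂), (mat γ (.inl 0) (.inl 0) : ZMod q) ≠ 0 →
      ∃ h ∈ cuspStab (N₀ * N₁ * N₂) M, (q : ℤ) ∣ mat (h * γ) (.inl 1) (.inl 0) := by
    intro γ h0
    set z : ZMod q := -(mat γ (.inl 1) (.inl 0) : ZMod q) /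
      ((r : ZMod q) * (mat γ (.inl 0) (.inl 0) : ZMod q)) with hz
    obtain ⟨h, hh⟩ := exists_pairRow_eq_lower (N := N₀ * N₁ * N₂) hM.isDiag (r := r * z.val)
      (by rw [hr, mul_right_comm, mul_assoc, mul_comm]
          obtain ⟨c, hc⟩ := hM.prime_dvd hqN 1
          exact ⟨z.val * c, by rw [hc]; ring⟩)
    refine ⟨h, mem_cuspStab_of_pairRow_eq hh (by simp [Matrix.det_fin_two]), ?_⟩
    rw [← ZMod.intCast_zmod_eq_zero_iff_dvd, cast_mat_mul_inl hM hqN hh]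
    simp only [Matrix.of_apply, Matrix.cons_val_zero, Matrix.cons_val_one,
      Matrix.cons_val_fin_one]
    push_cast
    rw [ZMod.natCast_zmod_val, hz]
    field_simp
    ring
  by_cases h0 : (mat γ (.inl 0) (.inl 0) : ZMod q) = 0
  · have h1 : (mat γ (.inl 1) (.inl 0) : ZMod q) ≠ 0 := by
      intro h1
      have e := sum_mul_sub_col γ 0 0
      have hC : ∀ i j, ((mat γ (.inr i) (.inl j) : ℤ) : ZMod q) = 0 :=
        fun i j => (ZMod.intCast_zmod_eq_zero_iff_dvd _ _).2
          ((Int.natCast_dvd_natCast.2 (hqN.trans ⟨N₀ * N₁, by ring⟩)).trans (γ.2 i j))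
      simp only [Fin.sum_univ_two, Matrix.one_apply_eq] at e
      have e' := congrArg (Int.cast : ℤ → ZMod q) e
      simp only [mat] at h0 h1 hC
      push_cast at e'
      rw [hC, hC, h0, h1] at e'
      simp at e'
    obtain ⟨h, hh⟩ := exists_pairRow_eq_upper (N := N₀ * N₁ * N₂) hM.isDiag (r := r)
      (by rw [hr]; exact mul_dvd_mul_left _ (hM.prime_dvd hqN 0))
    obtain ⟨h', hh', hd⟩ := main (h * γ) (by
      rw [cast_mat_mul_inl hM hqN hh, h0]
      simpa using ⟨hr', h1⟩)
    refine ⟨h' * h, mul_mem hh' (mem_cuspStab_of_pairRow_eq hh (by simp [Matrix.det_fin_two])), ?_⟩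
    have he : h' * h * γ = h' * (h * γ) := mul_assoc _ _ _
    rwa [he]
  · exact main γ h0

lemma exists_mem_cuspStab_mul_deltaConj (hN : Squarefree (N₀ * N₁ * N₂))
    (hM : IsCuspDiag N₀ N₁ N₂ M) (hq : q.Prime) (hqN : q ∣ N₂) (γ : Gamma0 (N₀ * N₁ * N₂)) :
    ∃ h ∈ cuspStab (N₀ * N₁ * N₂) M, ∃ k k', DeltaConj (N₀ * N₁ * N₂) q k k' ∧ γ = h * k' := by
  obtain ⟨h, hh, hA⟩ := exists_mem_cuspStab_dvd_inl hN hM hq hqN γ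
  set γ₁ := h * γ with hγ₁
  have hqp : Prime (q : ℤ) := Nat.prime_iff_prime_int.1 hq
  have hqN' : (q : ℤ) ∣ (N₀ * N₁ * N₂ : ℕ) :=
    Int.natCast_dvd_natCast.2 (hqN.trans ⟨N₀ * N₁, by ring⟩)
  obtain ⟨c0, hc0⟩ := γ₁.2 0 0
  obtain ⟨c1, hc1⟩ := γ₁.2 1 0
  set A0 := mat γ₁ (.inl 0) (.inl 0) with hA0
  set A1 := mat γ₁ (.inl 1) (.inl 0) with hA1
  have hc0 : mat γ₁ (.inr 0) (.inl 0) = (N₀ * N₁ * N₂ : ℕ) * c0 := hc0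
  have hc1 : mat γ₁ (.inr 1) (.inl 0) = (N₀ * N₁ * N₂ : ℕ) * c1 := hc1
  have hA0q : ¬ (q : ℤ) ∣ A0 := by
    intro hd
    have e := sum_mul_sub_col γ₁ 0 0
    simp only [Fin.sum_univ_two, Matrix.one_apply_eq] at e
    apply hqp.not_dvd_one
    rw [← e]
    exact dvd_add (dvd_sub (hd.mul_right _) ((hqN'.trans (γ₁.2 0 0)).mul_right _))
      (dvd_sub (hA.mul_right _) ((hqN'.trans (γ₁.2 1 0)).mul_right _))
  have hMq : ∀ i, ¬ (q : ℤ) ∣ M i i := fun i hd => hqp.not_dvd_one (by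
    have := dvd_sub hd (hM.prime_dvd hqN i)
    simpa using this)
  set u0 := M 0 0 * A0 + (N₀ * N₁ * N₂ : ℕ) * c0 with hu0
  set u1 := M 1 1 * A1 + (N₀ * N₁ * N₂ : ℕ) * c1 with hu1
  have hu0q : ¬ (q : ℤ) ∣ u0 := by
    intro hd
    have h1 : (q : ℤ) ∣ M 0 0 * A0 := (Int.dvd_add_left (hqN'.mul_right c0)).1 hd
    rcases hqp.dvd_or_dvd h1 with h1 | h1
    exacts [hMq 0 h1, hA0q h1]
  have hcop : ∀ i, IsCoprime (M i i * u0) (q : ℤ) := fun i => by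
    refine (IsCoprime.symm ?_)
    rw [hqp.coprime_iff_not_dvd]
    intro hd
    rcases hqp.dvd_or_dvd hd with h1 | h1
    exacts [hMq i h1, hu0q h1]
  -- Multiplying by `t` preserves the pair, so the shift of the `A` column by `NSu` changes the `C`
  -- column to `N(c₀ - M₀₀(x u₀ + y u₁))`, `N(c₁ - M₁₁ y u₀)`. As `u₀`, `M₀₀`, `M₁₁` are prime to
  -- `q`, one solves for `y` modulo `q`, then for `x` modulo `q²`.
  obtain ⟨y, hy⟩ := exists_dvd_sub_mul (hcop 1) c1
  obtain ⟨x, hx⟩ := exists_dvd_sub_mul ((hcop 0).pow_right (n := 2)) (c0 - M 0 0 * u1 * y)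
  obtain ⟨t, ht, htm⟩ := exists_pairRow_eq_one (N := N₀ * N₁ * N₂) hM.isDiag x y
  have hrow : ∀ i, M i i * mat (t * γ₁) (.inl i) (.inl 0) + mat (t * γ₁) (.inr i) (.inl 0) =
      M i i * mat γ₁ (.inl i) (.inl 0) + mat γ₁ (.inr i) (.inl 0) := fun i => by
    have h1 := congrFun (congrFun (pairRow_mul_of_pairRow_eq (y := (γ₁ : Sp2Z)) ht) i) (.inl 0)
    rwa [← Subgroup.coe_mul, Matrix.one_mul, pairRow_apply hM.isDiag, pairRow_apply hM.isDiag] at h1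
  have hcol : ∀ i, mat (t * γ₁) (.inl i) (.inl 0) = mat γ₁ (.inl i) (.inl 0) +
      (N₀ * N₁ * N₂ : ℕ) * ((!![x, y; y, 0] : Mat2 ℤ) i 0 * u0 +
        (!![x, y; y, 0] : Mat2 ℤ) i 1 * u1) := by
    intro i
    have h1 : mat (t * γ₁) = mat t * mat γ₁ := rfl
    rw [h1, Matrix.mul_apply]
    simp only [Fintype.sum_sum_type, Fin.sum_univ_two, htm, mul_cuspRow_inl hM.isDiag,
      mul_cuspRow_inr]
    rw [hc0, hc1, hu0, hu1, hA0, hA1]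
    rcases Fin.exists_fin_two.1 ⟨i, rfl⟩ with rfl | rfl <;> simp <;> ring
  have hcol0 := hcol 0
  have hcol1 := hcol 1
  have hrow0 := hrow 0
  have hrow1 := hrow 1
  simp only [Matrix.of_apply, Matrix.cons_val_zero, Matrix.cons_val_one,
    Matrix.cons_val_fin_one] at hcol0 hcol1
  rw [hcol0, hc0] at hrow0
  rw [hcol1, hc1] at hrow1
  obtain ⟨l, hl⟩ := exists_deltaConj_of_dvd hq (hqN.trans ⟨N₀ * N₁, by ring⟩) (t * γ₁)
    (by rw [hcol1]
        exact dvd_add hA (hqN'.mul_right _))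
    (by obtain ⟨w, hw⟩ := hx
        exact ⟨w, by linear_combination hrow0 + ((N₀ * N₁ * N₂ : ℕ) : ℤ) * hw⟩)
    (by obtain ⟨w, hw⟩ := hy
        exact ⟨w, by linear_combination hrow1 + ((N₀ * N₁ * N₂ : ℕ) : ℤ) * hw⟩)
  refine ⟨h⁻¹ * t⁻¹, mul_mem (inv_mem hh) (inv_mem
    (mem_cuspStab_of_pairRow_eq ht Matrix.det_one)), l, t * γ₁, hl, ?_⟩
  rw [hγ₁]
  group

end

end SiegelEis

/-! ### The double coset of `δ₁` and the stabilizer -/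

namespace SiegelEis

/-- The pair `(M I)` with rational entries. -/
def ratRow (M : Mat2 ℤ) : Matrix (Fin 2) (Fin 2 ⊕ Fin 2) ℚ := (cuspRow M).map (Int.castRingHom ℚ)

lemma map_pairRow (M : Mat2 ℤ) (γ : Sp2Z) :
    (pairRow M γ).map (Int.castRingHom ℚ) = ratRow M * toRat γ := by
  rw [pairRow, Matrix.map_mul, ratRow]
  rfl

lemma mul_ratRow_inr (M : Mat2 ℤ) (G : Mat2 ℚ) (i j : Fin 2) :
    (G * ratRow M) i (.inr j) = G i j := by
  have : ratRow M = Matrix.fromCols (M.map (Int.castRingHom ℚ)) 1 := by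
    ext i j
    rcases j with j | j <;> simp [ratRow, cuspRow, Matrix.one_apply]
  rw [this, Matrix.mul_fromCols, Matrix.fromCols_apply_inr, Matrix.mul_one]

/-- The right block of `(M I)` is the identity, so `G` can be read off from the pair and is
automatically integral. Rational `G` are needed to conjugate by `diag(q, 1)`. -/
lemma mem_cuspStab_iff_ratRow {N : ℕ} {M : Mat2 ℤ} {h : Gamma0 N} :
    h ∈ cuspStab N M ↔ ∃ G : Mat2 ℚ, G.det = 1 ∧ ratRow M * toRat h = G * ratRow M := by
  constructor
  · rintro ⟨G, hG⟩
    refine ⟨(G : Mat2 ℤ).map (Int.castRingHom ℚ), ?_, ?_⟩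
    · rw [← RingHom.mapMatrix_apply, ← RingHom.map_det, G.2, map_one]
    · rw [← map_pairRow, hG, Matrix.map_mul, ratRow]
  · rintro ⟨G, hdet, hG⟩
    rw [← map_pairRow] at hG
    have h1 : (pairRow M h).toCols₂.map (Int.castRingHom ℚ) = G := by
      ext i j
      rw [← mul_ratRow_inr M G i j, ← hG]
      rfl
    refine mem_cuspStab_of_pairRow_eq (G := (pairRow M h).toCols₂) ?_ ?_
    · apply Matrix.map_injective (Int.castRingHom ℚ).injective_int
      beta_reduce
      rw [hG, Matrix.map_mul, h1, ratRow]
    · apply (Int.castRingHom ℚ).injective_int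
      rw [RingHom.map_det, RingHom.mapMatrix_apply, h1, hdet, map_one]

variable {N₀ N₁ N₂ q : ℕ} {M : Mat2 ℤ}

/-- An element taking `(M I)` to the pair spanned by `(M I)δ₁⁻¹`. -/
lemma exists_pairRow_eq_fromCols (hM : IsCuspDiag N₀ N₁ N₂ M) (hqN : q ∣ N₂) :
    ∃ g : Gamma0 (N₀ * N₁ * N₂),
      pairRow M g = Matrix.fromCols M !![(q : ℤ) ^ 2, 0; 0, 1] ∧
      (N₀ : ℤ) ∣ (blockD g).det - q ^ 2 ∧ (N₁ : ℤ) ∣ (blockD g).det - 1 ∧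
      (N₂ : ℤ) ∣ (blockD g).det - 1 := by
  obtain ⟨c0, hc0⟩ := hM.zero 0
  obtain ⟨c1, hc1⟩ := hM.one
  obtain ⟨c2, hc2⟩ := hM.two 0
  obtain ⟨c3, hc3⟩ := hM.prime_dvd hqN 0
  have k1 : IsCoprime (N₁ : ℤ) (M 0 0) := ⟨-c1, 1, by linear_combination hc1⟩
  have k2 : IsCoprime (N₂ : ℤ) (M 0 0) := ⟨-c2, 1, by linear_combination hc2⟩
  have k3 : IsCoprime (q : ℤ) (M 0 0) := ⟨-c3, 1, by linear_combination hc3⟩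
  -- The aim is `a q² - b M₀₀ = 1` with `a ≡ 1` modulo `N₁N₂`. Then `C₀₀ = M₀₀(1 - a)` is divisible
  -- by `N`, and `det D = q² - M₀₀b = 1 + q²(1 - a)` is `q²` modulo `N₀` and 1 modulo `N₁N₂`.
  obtain ⟨x, y, hxy⟩ := (k1.mul_left k2).mul_left (k3.pow_left (m := 2))
  set t := x * (1 - (q : ℤ) ^ 2) with ht
  set a : ℤ := 1 + N₁ * N₂ * t with ha
  set b : ℤ := -(y * (1 - (q : ℤ) ^ 2)) with hb
  have hab : a * q ^ 2 - b * M 0 0 = 1 := by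
    rw [ha, hb, ht]
    linear_combination (1 - (q : ℤ) ^ 2) * hxy
  have hX : Matrix.fromBlocks !![a, 0; 0, 1] !![b, 0; 0, 0]
      !![M 0 0 * (1 - a), 0; 0, 0] !![(q : ℤ) ^ 2 - M 0 0 * b, 0; 0, 1] ∈
        Matrix.symplecticGroup (Fin 2) ℤ := by
    rw [SymplecticGroup.fromBlocks_mem_iff]
    refine ⟨?_, ?_, ?_⟩ <;> ext i j <;> fin_cases i <;> fin_cases j <;>
      simp [Matrix.mul_apply, Fin.sum_univ_two]
    · ring
    · ring
    · linear_combination hab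
  obtain ⟨g, hg⟩ := exists_coe_eq_fromBlocks (N := N₀ * N₁ * N₂) hX (fun i j => by
    fin_cases i <;> fin_cases j <;> simp
    exact ⟨-(c0 * t), by rw [ha]; linear_combination (-N₁ * N₂ * t) * hc0⟩)
  have hdet : (blockD g).det = (q : ℤ) ^ 2 - M 0 0 * b := by
    rw [det_blockD, hg]
    simp
  refine ⟨g, ?_, ?_, ?_, ?_⟩
  · ext i j
    rw [pairRow_apply hM.isDiag, hg]
    rcases j with j | j <;> fin_cases i <;> fin_cases j <;>
      simp [hM.isDiag zero_ne_one, hM.isDiag one_ne_zero]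
    ring
  · rw [hdet]
    exact ⟨-(c0 * b), by linear_combination (-b) * hc0⟩
  · rw [hdet]
    exact ⟨-(N₂ * t * q ^ 2), by rw [ha] at hab; linear_combination hab⟩
  · rw [hdet]
    exact ⟨-(N₁ * t * q ^ 2), by rw [ha] at hab; linear_combination hab⟩

lemma ratRow_mul_toRat_mul_delta1 (hM : M.IsDiag) (hq : q ≠ 0) {g : Sp2Z}
    (hg : pairRow M g = Matrix.fromCols M !![(q : ℤ) ^ 2, 0; 0, 1]) :
    ratRow M * toRat g * delta1 q = (!![(q : ℚ), 0; 0, 1] : Mat2 ℚ) * ratRow M := by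
  have hq' : (q : ℚ) ≠ 0 := by exact_mod_cast hq
  rw [← map_pairRow, hg, delta1_eq_diagonal]
  ext i j
  rw [Matrix.mul_diagonal]
  rcases j with j | j
  · fin_cases i <;> fin_cases j <;>
      simp [ratRow, cuspRow, deltaDiag, Matrix.mul_apply, Fin.sum_univ_two, hM zero_ne_one,
        hM one_ne_zero]
    ring
  · rw [mul_ratRow_inr]
    fin_cases i <;> fin_cases j <;> simp [deltaDiag]
    field_simp

/-- Conjugation by `δ₁⁻¹g⁻¹` preserves the condition of stabilizing the cusp. -/
lemma mem_cuspStab_iff_of_deltaConj (hM : M.IsDiag) (hq : q ≠ 0) {N : ℕ} {g : Gamma0 N}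
    (hg : pairRow M g = Matrix.fromCols M !![(q : ℤ) ^ 2, 0; 0, 1]) {x k' : Gamma0 N}
    (h : DeltaConj N q (g⁻¹ * x * g) k') : x ∈ cuspStab N M ↔ k' ∈ cuspStab N M := by
  have hq' : (q : ℚ) ≠ 0 := by exact_mod_cast hq
  set E : Mat2 ℚ := !![(q : ℚ), 0; 0, 1] with hE
  have hEu : IsUnit E.det := by simp [hE, Matrix.det_fin_two, hq']
  have hδ : IsUnit (delta1 q).det := SymplecticGroup.symplectic_det (delta1_mem hq)
  have key : ratRow M * toRat g * delta1 q = E * ratRow M := ratRow_mul_toRat_mul_delta1 hM hq hg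
  have hgg : toRat g * toRat (g⁻¹ : Gamma0 N) = 1 := by
    rw [← toRat_mul, mul_inv_cancel, toRat_one]
  have h1 : ratRow M * toRat x * toRat g * delta1 q = E * (ratRow M * toRat k') := by
    have h2 : toRat (g⁻¹ * x * g : Gamma0 N) = toRat (g⁻¹ : Gamma0 N) * toRat x * toRat g := by
      rw [toRat_mul, toRat_mul]
    have h3 : ratRow M * toRat g * (toRat (g⁻¹ * x * g : Gamma0 N) * delta1 q) =
        ratRow M * toRat g * (delta1 q * toRat k') := by rw [h]
    rw [h2] at h3
    have h4 : ratRow M * toRat g * (toRat (g⁻¹ : Gamma0 N) * toRat x * toRat g * delta1 q) =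
        ratRow M * (toRat g * toRat (g⁻¹ : Gamma0 N)) * toRat x * toRat g * delta1 q := by
      simp only [Matrix.mul_assoc]
    rw [h4, hgg, Matrix.mul_one, ← Matrix.mul_assoc, key] at h3
    rw [h3, Matrix.mul_assoc]
  rw [mem_cuspStab_iff_ratRow, mem_cuspStab_iff_ratRow]
  constructor
  · rintro ⟨G, hG, hx⟩
    refine ⟨E⁻¹ * G * E, ?_, ?_⟩
    · rw [Matrix.det_mul, Matrix.det_mul, mul_right_comm, ← Matrix.det_mul,
        Matrix.nonsing_inv_mul _ hEu, Matrix.det_one, one_mul, hG]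
    · have h2 : G * (E * ratRow M) = E * (ratRow M * toRat k') := by
        rw [← h1, hx, ← key]
        simp only [Matrix.mul_assoc]
      calc ratRow M * toRat k' = E⁻¹ * (E * (ratRow M * toRat k')) := by
            rw [← Matrix.mul_assoc, Matrix.nonsing_inv_mul _ hEu, Matrix.one_mul]
        _ = _ := by rw [← h2]; simp only [Matrix.mul_assoc]
  · rintro ⟨G, hG, hx⟩
    refine ⟨E * G * E⁻¹, ?_, ?_⟩
    · rw [Matrix.det_mul, Matrix.det_mul, mul_right_comm, ← Matrix.det_mul,
        Matrix.mul_nonsing_inv _ hEu, Matrix.det_one, one_mul, hG]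
    · have h2 : ratRow M * toRat x * toRat g * delta1 q =
          E * G * E⁻¹ * ratRow M * toRat g * delta1 q := by
        rw [h1, hx]
        calc E * (G * ratRow M) = E * G * (E⁻¹ * E) * ratRow M := by
              rw [Matrix.nonsing_inv_mul _ hEu, Matrix.mul_one, Matrix.mul_assoc]
          _ = E * G * E⁻¹ * (E * ratRow M) := by simp only [Matrix.mul_assoc]
          _ = _ := by rw [← key]; simp only [Matrix.mul_assoc]
      have h3 := congrArg (fun X : Matrix (Fin 2) (Fin 2 ⊕ Fin 2) ℚ =>
        (X * ((delta1 q)⁻¹ * toRat (g⁻¹ : Gamma0 N)) : Matrix (Fin 2) (Fin 2 ⊕ Fin 2) ℚ)) h2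
      simp only [Matrix.mul_assoc] at h3 ⊢
      have h4 : toRat g * (delta1 q * ((delta1 q)⁻¹ * toRat (g⁻¹ : Gamma0 N))) = 1 := by
        rw [← Matrix.mul_assoc (delta1 q), Matrix.mul_nonsing_inv _ hδ, Matrix.one_mul, hgg]
      simpa only [h4, Matrix.mul_one] using h3

/-- With `k = g⁻¹hg`, the relation `(M I)g k = G (M I)g` compares entries of `k` and `G`. Since `M`
is invertible and `C ≡ 0` modulo `q`, all five divisibilities defining the conjugated group reduce
to the one on `G₀₁`. -/
lemma conj_mem_conjInter_iff (hM : IsCuspDiag N₀ N₁ N₂ M) (hq : q.Prime) (hqN : q ∣ N₂)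
    {g h : Gamma0 (N₀ * N₁ * N₂)} (hg : pairRow M g = Matrix.fromCols M !![(q : ℤ) ^ 2, 0; 0, 1])
    {G : Mat2 ℤ} (hh : pairRow M h = G * cuspRow M) :
    g⁻¹ * h * g ∈ conjInter (N₀ * N₁ * N₂) (delta1 q) ↔ (q : ℤ) ∣ G 0 1 := by
  have hqp : Prime (q : ℤ) := Nat.prime_iff_prime_int.1 hq
  have hMq : ∀ i, ¬ (q : ℤ) ∣ M i i := fun i hd => hqp.not_dvd_one (by
    simpa using dvd_sub hd (hM.prime_dvd hqN i))
  set k := g⁻¹ * h * g with hk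
  have hC : ∀ i j, (q : ℤ) ∣ mat k (.inr i) (.inl j) := fun i j =>
    (Int.natCast_dvd_natCast.2 (hqN.trans ⟨N₀ * N₁, by ring⟩)).trans (k.2 i j)
  have h1 : pairRow M g * mat k = G * pairRow M g := by
    have : g * k = h * g := by rw [hk]; group
    rw [← pairRow_mul_of_pairRow_eq hh, ← Subgroup.coe_mul, ← this, Subgroup.coe_mul, pairRow_mul]
  rw [hg] at h1
  have e := fun i j => congrFun (congrFun h1 i) j
  simp only [Matrix.mul_apply, Fintype.sum_sum_type, Fin.sum_univ_two, Matrix.fromCols_apply_inl,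
    Matrix.fromCols_apply_inr] at e
  have l01 := e 0 (.inl 1)
  have r00 := e 0 (.inr 0)
  have r01 := e 0 (.inr 1)
  have r10 := e 1 (.inr 0)
  simp [hM.isDiag zero_ne_one, hM.isDiag one_ne_zero] at l01 r00 r01 r10
  constructor
  · rintro ⟨k', hkk⟩
    have hA := (deltaConj_iff.1 hkk) (.inl 0) (.inl 1)
    simp only [deltaDiag, Sum.elim_inl, Matrix.cons_val_zero, Matrix.cons_val_one,
      Matrix.cons_val_fin_one, mul_one] at hA
    have hA' : (q : ℤ) ∣ mat k (.inl 0) (.inl 1) :=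
      ⟨mat k' (.inl 0) (.inl 1), by exact_mod_cast hA⟩
    have h2 : (q : ℤ) ∣ G 0 1 * M 1 1 := by
      rw [← l01]
      exact dvd_add (hA'.mul_left _) ((hC 0 1).mul_left _)
    exact (hqp.dvd_or_dvd h2).resolve_right (hMq 1)
  · intro hG
    have hA : (q : ℤ) ∣ mat k (.inl 0) (.inl 1) := by
      refine (hqp.dvd_or_dvd (a := M 0 0) ?_).resolve_left (hMq 0)
      have h2 := dvd_sub (hG.mul_right (M 1 1)) ((hC 0 1).mul_left ((q : ℤ) ^ 2))
      rwa [← l01, add_sub_cancel_right] at h2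
    have hcop2 : IsCoprime ((q : ℤ) ^ 2) (M 0 0) :=
      ((hqp.coprime_iff_not_dvd).2 (hMq 0)).pow_left
    have hB : (q : ℤ) ^ 2 ∣ mat k (.inl 0) (.inr 0) := by
      refine hcop2.dvd_of_dvd_mul_left ?_
      exact ⟨G 0 0 - mat k (.inr 0) (.inr 0), by linear_combination r00⟩
    have hB1 : (q : ℤ) ∣ mat k (.inl 0) (.inr 1) := by
      refine (hqp.dvd_or_dvd (a := M 0 0) ?_).resolve_left (hMq 0)
      obtain ⟨w, hw⟩ := hG
      exact ⟨w - q * mat k (.inr 0) (.inr 1), by rw [hw] at r01; linear_combination r01⟩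
    have s00 := sum_mul_sub_row k 0 0
    have s01 := sum_mul_sub_row k 0 1
    simp only [Fin.sum_univ_two, Matrix.one_apply_eq, Matrix.one_apply_ne zero_ne_one] at s00 s01
    have hA0 : ¬ (q : ℤ) ∣ mat k (.inl 0) (.inl 0) := by
      intro hd
      apply hqp.not_dvd_one
      rw [← s00]
      exact dvd_add (dvd_sub (hd.mul_right _) ((hC 0 0).mul_left _))
        (dvd_sub (hA.mul_right _) ((hC 0 1).mul_left _))
    have hD : (q : ℤ) ∣ mat k (.inr 1) (.inr 0) := by
      refine (hqp.dvd_or_dvd (a := mat k (.inl 0) (.inl 0)) ?_).resolve_left hA0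
      have h2 := dvd_sub (dvd_add ((hC 1 0).mul_left (mat k (.inl 0) (.inr 0)))
        ((hC 1 1).mul_left (mat k (.inl 0) (.inr 1)))) (hA.mul_right (mat k (.inr 1) (.inr 1)))
      convert h2 using 1
      linear_combination s01
    have hB2 : (q : ℤ) ∣ mat k (.inl 1) (.inr 0) := by
      refine (hqp.dvd_or_dvd (a := M 1 1) ?_).resolve_left (hMq 1)
      obtain ⟨w, hw⟩ := hD
      exact ⟨G 1 0 * q - w, by linear_combination r10 - hw⟩
    exact mem_conjInter_of_dvd hq.ne_zero k hA hD hB hB1 hB2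

/-- Coset representatives, indexed by the projective line over `𝔽_q`. -/
lemma exists_rep_cuspStab (hN : Squarefree (N₀ * N₁ * N₂)) (hM : IsCuspDiag N₀ N₁ N₂ M)
    (hq : q.Prime) (hqN : q ∣ N₂) {g : Gamma0 (N₀ * N₁ * N₂)}
    (hg : pairRow M g = Matrix.fromCols M !![(q : ℤ) ^ 2, 0; 0, 1]) :
    ∃ rep : Option (ZMod q) → Gamma0 (N₀ * N₁ * N₂),
      (∀ i, rep i ∈ cuspStab (N₀ * N₁ * N₂) M) ∧
      ∀ h ∈ cuspStab (N₀ * N₁ * N₂) M,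
        ∃! i, g⁻¹ * (h * (rep i)⁻¹) * g ∈ conjInter (N₀ * N₁ * N₂) (delta1 q) := by
  have : Fact q.Prime := ⟨hq⟩
  obtain ⟨r, hr, hqr⟩ := exists_level_eq hN hq hqN
  have hr' : (r : ZMod q) ≠ 0 := fun h => hqr ((ZMod.intCast_zmod_eq_zero_iff_dvd _ _).1 h)
  have hdvd : ∀ i (x : ℤ), ((N₀ * N₁ * N₂ : ℕ) : ℤ) ∣ r * x * (M i i - 1) := fun i x => by
    obtain ⟨c, hc⟩ := hM.prime_dvd hqN i
    exact ⟨x * c, by rw [hc, hr]; ring⟩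
  choose U hU using fun x : ℤ =>
    exists_pairRow_eq_upper (N := N₀ * N₁ * N₂) hM.isDiag (hdvd 0 x)
  choose L hL using fun x : ℤ =>
    exists_pairRow_eq_lower (N := N₀ * N₁ * N₂) hM.isDiag (hdvd 1 x)
  -- Chosen so that the representative for `none` has first row `(1 + r²z, r) ≡ (0, r)`, the point
  -- at infinity; `some s` has first row `(1, rs)`.
  set z : ZMod q := -((r : ZMod q) ^ 2)⁻¹ with hz
  let rep : Option (ZMod q) → Gamma0 (N₀ * N₁ * N₂) := fun i =>
    i.elim (U 1 * L z.val) fun s => U s.val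
  let R : Option (ZMod q) → Mat2 ℤ := fun i =>
    i.elim (!![1, r * 1; 0, 1] * !![1, 0; r * z.val, 1]) fun s => !![1, r * s.val; 0, 1]
  have hR : ∀ i, pairRow M (rep i) = R i * cuspRow M := by
    rintro (_ | s)
    · simp only [rep, R, Option.elim]
      rw [Subgroup.coe_mul, pairRow_mul_of_pairRow_eq (hU 1), hL, Matrix.mul_assoc]
    · exact hU _
  have hRdet : ∀ i, (R i).det = 1 := by
    rintro (_ | s) <;> simp [R, Matrix.det_fin_two]
  refine ⟨rep, fun i => mem_cuspStab_of_pairRow_eq (hR i) (hRdet i), ?_⟩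
  rintro h ⟨⟨G, hdet⟩, hG⟩
  change pairRow M h = G * cuspRow M at hG
  -- The upper right entry of `G (R i)⁻¹` vanishes modulo `q` exactly when the first rows of `G` and
  -- `R i` are proportional.
  have hcrit : ∀ i, g⁻¹ * (h * (rep i)⁻¹) * g ∈ conjInter (N₀ * N₁ * N₂) (delta1 q) ↔
      (G 0 1 : ZMod q) * (R i 0 0 : ZMod q) - (G 0 0 : ZMod q) * (R i 0 1 : ZMod q) = 0 := by
    intro i
    rw [conj_mem_conjInter_iff hM hq hqN hg
      (by rw [Subgroup.coe_mul, Subgroup.coe_inv]; exact pairRow_mul_inv hG (hR i) (hRdet i)),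
      ← ZMod.intCast_zmod_eq_zero_iff_dvd, Matrix.adjugate_fin_two]
    simp only [Matrix.mul_apply, Fin.sum_univ_two, Matrix.of_apply, Matrix.cons_val_zero,
      Matrix.cons_val_one, Matrix.cons_val_fin_one]
    push_cast
    rw [show ∀ a b c d : ZMod q, a * -b + c * d = c * d - a * b by intros; ring]
  have hcrit_some : ∀ s : ZMod q, g⁻¹ * (h * (rep (some s))⁻¹) * g ∈
      conjInter (N₀ * N₁ * N₂) (delta1 q) ↔
      (G 0 1 : ZMod q) - (G 0 0 : ZMod q) * (r * s) = 0 := by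
    intro s
    rw [hcrit]
    simp [R]
  have hcrit_none : g⁻¹ * (h * (rep none)⁻¹) * g ∈ conjInter (N₀ * N₁ * N₂) (delta1 q) ↔
      (G 0 0 : ZMod q) = 0 := by
    rw [hcrit]
    have : (R none 0 0 : ZMod q) = 0 := by
      simp [R, hz]
      field_simp
      ring
    rw [this]
    simp [R, hr']
  by_cases h0 : (G 0 0 : ZMod q) = 0
  · refine ⟨none, hcrit_none.2 h0, ?_⟩
    rintro (_ | s) hs
    · rfl
    · exfalso
      rw [hcrit_some, h0, zero_mul, sub_zero] at hs
      have := congrArg (Int.cast : ℤ → ZMod q) hdet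
      rw [Matrix.det_fin_two] at this
      push_cast at this
      rw [h0, hs] at this
      simp at this
  · refine ⟨some ((G 0 1 : ZMod q) / ((G 0 0 : ZMod q) * r)), ?_, ?_⟩
    · dsimp only
      rw [hcrit_some]
      field_simp
      ring
    · rintro (_ | s) hs
      · exact absurd (hcrit_none.1 hs) h0
      · rw [hcrit_some] at hs
        rw [Option.some.injEq, eq_div_iff (mul_ne_zero h0 hr')]
        linear_combination -hs

end SiegelEis

/-! ### The Hecke operator on the Eisenstein series -/

namespace SiegelEis

/-- Only the cocycle relation for the automorphy factor is kept; that the image point `z` lies in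
the half space is not needed. -/
lemma slash_eq {k : ℕ} {f : Mat2 ℂ → ℂ} {g : Mat4 ℚ} {τ : Mat2 ℂ}
    (hg : g ∈ Matrix.symplecticGroup (Fin 2) ℚ) (hτ : τ ∈ siegelHalfSpace) :
    ∃ (z : Mat2 ℂ) (j : ℂ), j ≠ 0 ∧ slash k f g τ = (j ^ k)⁻¹ * f z ∧
      ∀ W : Matrix (Fin 2) (Fin 2 ⊕ Fin 2) ℂ,
        (autFactor W z).det * j = (autFactor (W * g.map (Rat.castHom ℂ)) τ).det := by
  set c : ℚ → ℂ := fun x => (x : ℂ) with hc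
  set A := g.toBlocks₁₁.map c with hA
  set B := g.toBlocks₁₂.map c with hB
  set C := g.toBlocks₂₁.map c with hC
  set D := g.toBlocks₂₂.map c with hD
  have hgC : g.map (Rat.castHom ℂ) = Matrix.fromBlocks A B C D := by
    ext i j
    rcases i with i | i <;> rcases j with j | j <;> rfl
  have hmem : g.map (Rat.castHom ℂ) ∈ Matrix.symplecticGroup (Fin 2) ℂ :=
    SymplecticGroup.map_mem hg _
  have hj : (C * τ + D).det ≠ 0 := by
    have hrow : C * τ + D = autFactor
        (Matrix.fromCols (0 : Mat2 ℂ) (1 : Mat2 ℂ) * g.map (Rat.castHom ℂ)) τ := by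
      rw [autFactor, hgC, Matrix.fromCols_mul_fromBlocks, Matrix.fromCols_mul_fromRows]
      simp
    rw [hrow]
    let γ : Matrix.symplecticGroup (Fin 2) ℂ := ⟨_, hmem⟩
    have hinv : g.map (Rat.castHom ℂ) * ((γ⁻¹ : Matrix.symplecticGroup (Fin 2) ℂ) : Mat4 ℂ) = 1 :=
      congrArg Subtype.val (mul_inv_cancel γ)
    refine isUnit_det_autFactor (IsSymmPair.mul (by simp [IsSymmPair, minor]) hmem) ?_
      (X := ((γ⁻¹ : Matrix.symplecticGroup (Fin 2) ℂ) : Mat4 ℂ) *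
        Matrix.fromRows (0 : Mat2 ℂ) (1 : Mat2 ℂ)) ?_ hτ
    · intro i j
      rw [hgC, Matrix.fromCols_mul_fromBlocks]
      rcases j with j | j <;> simp [hC, hD, hc]
    · rw [Matrix.mul_assoc, ← Matrix.mul_assoc (g.map (Rat.castHom ℂ)), hinv, Matrix.one_mul,
        Matrix.fromCols_mul_fromRows]
      simp
  refine ⟨(A * τ + B) * (C * τ + D)⁻¹, (C * τ + D).det, hj, ?_, fun W => ?_⟩
  · have hdet : g.det = 1 := SymplecticGroup.det_eq_one hg
    simp only [slash, hdet]
    simp [hA, hB, hC, hD, hc]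
  · rw [← Matrix.det_mul, autFactor, autFactor, Matrix.mul_assoc, Matrix.mul_assoc]
    congr 2
    rw [hgC, Matrix.fromBlocks_mul_fromRows, Matrix.fromRows_mul, Matrix.mul_assoc,
      Matrix.nonsing_inv_mul _ (isUnit_iff_ne_zero.2 hj)]
    simp

end SiegelEis

open SiegelEis in
theorem proposition3p8 (N₀ N₁ N₂ k q : ℕ) (hk : 4 ≤ k)
    (hN : Squarefree (N₀ * N₁ * N₂))
    (χ : DirichletCharacter ℂ (N₀ * N₁ * N₂))
    (χ₀ : DirichletCharacter ℂ N₀) (χ₁ : DirichletCharacter ℂ N₁) (χ₂ : DirichletCharacter ℂ N₂)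
    (hχ : ∀ a : ℤ, χ (a : ZMod (N₀ * N₁ * N₂)) =
      χ₀ (a : ZMod N₀) * χ₁ (a : ZMod N₁) * χ₂ (a : ZMod N₂))
    (hχ₁ : χ₁ ^ 2 = 1)
    (M : Matrix (Fin 2) (Fin 2) ℤ) (hM : SiegelEis.IsCuspMatrix N₀ N₁ N₂ M)
    (hq : q.Prime) (hqN : q ∣ N₂) :
    ∀ τ ∈ SiegelEis.siegelHalfSpace,
      Summable (fun c : SiegelEis.PairClass (N₀ * N₁ * N₂) M =>
        SiegelEis.eisTerm (N₀ * N₁ * N₂) k χ M (c.out : SiegelEis.Gamma0 (N₀ * N₁ * N₂)) τ) ∧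
      SiegelEis.heckeT1 (N₀ * N₁ * N₂) k χ q
          (SiegelEis.eisenstein (N₀ * N₁ * N₂) k χ M) τ =
        χ₀ ((q : ZMod N₀) ^ 2) * ((q : ℂ) + 1) * (q : ℂ) ^ (2 * k - 3) *
          SiegelEis.eisenstein (N₀ * N₁ * N₂) k χ M τ := by
  intro τ hτ
  have hsum := summable_eisTerm (N₀ * N₁ * N₂) k hk χ hM.isDiag hτ
  refine ⟨hsum, ?_⟩
  have hD := hM.isCuspDiag hN
  have hqC : (q : ℂ) ≠ 0 := by exact_mod_cast hq.ne_zero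
  have : Fact q.Prime := ⟨hq⟩
  have hfin : Finite (HeckeCoset (N₀ * N₁ * N₂) q) := finite_heckeCoset (N₀ * N₁ * N₂) q hN.ne_zero hq.ne_zero
  obtain ⟨g, hg, hg0, hg1, hg2⟩ := exists_pairRow_eq_fromCols hD hqN
  obtain ⟨rep, hrep, hrepK⟩ := exists_rep_cuspStab hN hD hq hqN hg
  -- the value of the character at `g`
  have hχg : χ ((blockD g).det : ZMod (N₀ * N₁ * N₂)) = χ₀ ((q : ZMod N₀) ^ 2) := by
    have e0 := (ZMod.intCast_zmod_eq_zero_iff_dvd _ _).2 hg0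
    have e1 := (ZMod.intCast_zmod_eq_zero_iff_dvd _ _).2 hg1
    have e2 := (ZMod.intCast_zmod_eq_zero_iff_dvd _ _).2 hg2
    rw [Int.cast_sub, sub_eq_zero] at e0 e1 e2
    rw [hχ, e0, e1, e2]
    simp
  -- `det D_g` is invertible modulo the level, with inverse `det D_{g⁻¹}`, so its character value
  -- has absolute value 1.
  have hχu : χ₀ ((q : ZMod N₀) ^ 2) * (starRingEnd ℂ) (χ₀ ((q : ZMod N₀) ^ 2)) = 1 := by
    have h1 : χ ((blockD g).det : ZMod (N₀ * N₁ * N₂)) * χ ((blockD (g⁻¹ : Gamma0 (N₀ * N₁ * N₂))).det : ZMod (N₀ * N₁ * N₂)) = 1 := by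
      rw [← map_mul, ← cast_det_blockD_mul, mul_inv_cancel]
      simp [Matrix.toBlocks₂₂, Matrix.det_fin_two]
    have h2 := congrArg norm h1
    rw [norm_mul, norm_one] at h2
    have h3 := DirichletCharacter.norm_le_one χ ((blockD g).det : ZMod (N₀ * N₁ * N₂))
    have h4 := DirichletCharacter.norm_le_one χ ((blockD (g⁻¹ : Gamma0 (N₀ * N₁ * N₂))).det : ZMod (N₀ * N₁ * N₂))
    have h5 : ‖χ ((blockD g).det : ZMod (N₀ * N₁ * N₂))‖ = 1 := by
      nlinarith [norm_nonneg (χ ((blockD g).det : ZMod (N₀ * N₁ * N₂)))]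
    rw [← hχg, Complex.mul_conj, Complex.normSq_eq_norm_sq, h5]
    simp
  -- the terms of the Hecke operator
  have hδ : (delta1 q)⁻¹ ∈ Matrix.symplecticGroup (Fin 2) ℚ := by
    let δ : Matrix.symplecticGroup (Fin 2) ℚ := ⟨delta1 q, delta1_mem hq.ne_zero⟩
    have := (δ⁻¹).2
    rwa [SymplecticGroup.coe_inv'] at this
  choose z j hj hslash haut using fun γ : Gamma0 (N₀ * N₁ * N₂) =>
    slash_eq (k := k) (f := eisenstein (N₀ * N₁ * N₂) k χ M) (mul_mem hδ (toRat_mem γ)) hτ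
  let F : Gamma0 (N₀ * N₁ * N₂) → Gamma0 (N₀ * N₁ * N₂) → ℂ := fun γ₁ γ₂ =>
    (starRingEnd ℂ) (χ ((blockD γ₂).det : ZMod (N₀ * N₁ * N₂))) * (j γ₂ ^ k)⁻¹ * (1 / 2) *
      eisTerm (N₀ * N₁ * N₂) k χ M γ₁ (z γ₂)
  let f : Gamma0 (N₀ * N₁ * N₂) → ℂ := fun γ => eisTerm (N₀ * N₁ * N₂) k χ M γ τ
  have hFf : ∀ {l l' : Gamma0 (N₀ * N₁ * N₂)}, DeltaConj (N₀ * N₁ * N₂) q l l' → ∀ γ₂, F l' γ₂ =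
      (χ₀ ((q : ZMod N₀) ^ 2) * q ^ k * (1 / 2)) * f (g⁻¹⁻¹ * (l * γ₂)) := by
    intro l l' hl γ₂
    set E : Mat2 ℚ := !![(q : ℚ), 0; 0, 1] with hE
    have hδu : IsUnit (delta1 q).det := SymplecticGroup.symplectic_det (delta1_mem hq.ne_zero)
    -- The pair of `l'` translated by `δ₁⁻¹γ₂` is, up to `E` of determinant `q`, the pair of `g l
    -- γ₂`; this produces the factor `q^k`.
    have hrat : E * (ratRow M * toRat l' * ((delta1 q)⁻¹ * toRat γ₂)) =
        ratRow M * toRat (g * (l * γ₂) : Gamma0 (N₀ * N₁ * N₂)) := by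
      have key := ratRow_mul_toRat_mul_delta1 hM.isDiag hq.ne_zero hg
      calc E * (ratRow M * toRat l' * ((delta1 q)⁻¹ * toRat γ₂))
          = (E * ratRow M) * toRat l' * ((delta1 q)⁻¹ * toRat γ₂) := by
            simp only [Matrix.mul_assoc]
        _ = ratRow M * toRat g * (delta1 q * toRat l') * ((delta1 q)⁻¹ * toRat γ₂) := by
            rw [hE, ← key]; simp only [Matrix.mul_assoc]
        _ = ratRow M * toRat g * (toRat l * (delta1 q * (delta1 q)⁻¹) * toRat γ₂) := by
            rw [← hl]; simp only [Matrix.mul_assoc]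
        _ = _ := by
            rw [Matrix.mul_nonsing_inv _ hδu, Matrix.mul_one, toRat_mul, toRat_mul,
              Matrix.mul_assoc]
    have hcast : ∀ γ : Gamma0 (N₀ * N₁ * N₂), (pairRow M γ).map (Int.castRingHom ℂ) =
        (ratRow M * toRat γ).map (Rat.castHom ℂ) := by
      intro γ
      rw [← map_pairRow, Matrix.map_map]
      ext i j
      simp
    have hdet : (autFactor ((pairRow M (g * (l * γ₂) : Gamma0 (N₀ * N₁ * N₂))).map (Int.castRingHom ℂ)) τ).det =
        q * ((autFactor ((pairRow M l').map (Int.castRingHom ℂ)) (z γ₂)).det * j γ₂) := by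
      rw [haut, hcast, hcast, ← hrat, Matrix.map_mul, Matrix.map_mul (L := ratRow M * toRat l')]
      rw [autFactor, autFactor, Matrix.mul_assoc, Matrix.det_mul]
      congr 1
      simp [hE, Matrix.det_fin_two]
    simp only [F, f, inv_inv]
    rw [eisTerm_eq, eisTerm_eq, hdet, cast_det_blockD_mul, cast_det_blockD_mul, map_mul, map_mul,
      map_mul, map_mul, hχg, hl.det_blockD_eq hq.ne_zero]
    have hA : (autFactor ((pairRow M l').map (Int.castRingHom ℂ)) (z γ₂)).det ^ k ≠ 0 := by
      refine pow_ne_zero _ fun h0 => ?_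
      rw [h0, zero_mul, mul_zero] at hdet
      exact det_autFactor_pairRow_ne_zero hM.isDiag _ hτ hdet
    have hjk := pow_ne_zero k (hj γ₂)
    have hqk := pow_ne_zero k hqC
    rw [mul_pow, mul_pow, mul_inv, mul_inv]
    generalize (autFactor ((pairRow M l').map (Int.castRingHom ℂ)) (z γ₂)).det ^ k = x at *
    generalize (starRingEnd ℂ) (χ ((blockD γ₂).det : ZMod (N₀ * N₁ * N₂))) = c₁
    generalize (starRingEnd ℂ) (χ ((blockD l).det : ZMod (N₀ * N₁ * N₂))) = c₂
    field_simp
    linear_combination (-(c₁ * c₂)) * hχu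
  have main := finsum_tsum_rightCosets (s := pairSetoid (N₀ * N₁ * N₂) M) (K := conjInter (N₀ * N₁ * N₂) (delta1 q))
    (R := DeltaConj (N₀ * N₁ * N₂) q) (σ := g⁻¹) pairSetoid_iff_mem_cuspStab (fun _ => mem_conjInter)
    (fun h h' => h.mul h') (fun h => h.inv)
    (fun {x k'} h => mem_cuspStab_iff_of_deltaConj hM.isDiag hq.ne_zero hg (by rwa [inv_inv] at h))
    (exists_mem_cuspStab_mul_deltaConj hN hD hq hqN) hrep
    (fun h hh => by simpa only [inv_inv] using hrepK h hh)
    (F := F) (f := f)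
    (fun h hh γ₁ γ₂ => by
      simp only [F]
      rw [eisTerm_mul_left k hχ hχ₁ hD hh])
    (fun h hh γ => eisTerm_mul_left k hχ hχ₁ hD hh γ τ) hFf hsum
  have hterm : ∀ κ : HeckeCoset (N₀ * N₁ * N₂) q, (starRingEnd ℂ) (χ ((blockD (κ.out : Gamma0 (N₀ * N₁ * N₂))).det : ZMod (N₀ * N₁ * N₂))) *
      slash k (eisenstein (N₀ * N₁ * N₂) k χ M) ((delta1 q)⁻¹ * toRat (κ.out : Gamma0 (N₀ * N₁ * N₂))) τ =
      ∑' c : PairClass (N₀ * N₁ * N₂) M, F c.out κ.out := by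
    intro κ
    simp only [F]
    rw [hslash, tsum_mul_left, eisenstein]
    ring
  rw [heckeT1, finsum_congr hterm, main, Fintype.card_option, ZMod.card, eisenstein]
  -- The normalization of the operator meets the `q^k` from `diag(q, 1)`; `k ≥ 4` makes the
  -- truncated exponent `2k - 3` the true one.
  have hpow : (q : ℂ) ^ ((k : ℤ) - 3) * (q : ℂ) ^ k = (q : ℂ) ^ (2 * k - 3) := by
    rw [← zpow_natCast, ← zpow_natCast, ← zpow_add₀ hqC]
    congr 1
    omega
  rw [← hpow]
  push_cast
  ring

end
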